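/- Let $k$ be a field and let $Q=(Q_0,Q_1,s,t)$ be a quiver, where the sets $Q_0$ of vertices and $Q_1$ of arrows may be infinite. Let $Q_n$ be the set of paths of length $n$, and let $kQ=\bigoplus_{n\ge 0}kQ_n$ be the path coalgebra of $Q$: the vector space with basis the paths $p=a_n\cdots a_1$ (with $s(a_{i+1})=t(a_i)$; the vertices are the paths of length $0$), with $$\Delta(g)=g\otimes g,\qquad \varepsilon(g)=1\qquad (g\in Q_0),$$ $$\Delta(p)=t(a_n)\otimes p+\sum_{i=1}^{n-1}a_n\cdots a_{i+1}\otimes a_i\cdots a_1+p\otimes s(a_1),\qquad \varepsilon(p)=0\qquad (p=a_n\cdots a_1,\ n\ge1).$$ A bialgebra structure on $kQ$ is an associative unital algebra structure on the vector space $kQ$ for which $\Delta$ and $\varepsilon$ are algebra maps; it is graded if $1\in kQ_0$ and $kQ_m\cdot kQ_n\subseteq kQ_{m+n}$ for all $m,n\ge 0$. For a bialgebra $B$, a $B$-bialgebra bimodule is a vector space $M$ that is both a $B$-bimodule and a $B$-bicomodule, such that the coactions $M\to B\otimes M$ and $M\to M\otimes B$ are maps of $B$-bimodules, where $B\otimes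 M$ and $M\otimes B$ carry the diagonal actions. For a monoid structure $S$ on $Q_0$, let $kS$ be the monoid bialgebra (the space $kQ_0$ with all vertices group-like). A $kS$-bialgebra bimodule structure on $kQ_1$ means one whose bicomodule structure is that given by the quiver, $\delta_L(a)=t(a)\otimes a$ and $\delta_R(a)=a\otimes s(a)$ for $a\in Q_1$. Then: 1. The path coalgebra $kQ$ admits a bialgebra structure if and only if there is a monoid structure $S$ on $Q_0$ such that $kQ_1$ admits a $kS$-bialgebra bimodule structure. 2. The graded bialgebra structures on $kQ$ are in one-to-one correspondence with the pairs $(S,M)$ in which $S$ is a monoid structure on $Q_0$ and $M$ is a $kS$-bialgebra bimodule structure on $kQ_1$. The correspondence sends a graded bialgebra structure to the pair in which the multiplication and the unit of $kS$ are those of $kQ$ restricted to $kQ_0$, and the left and right actions of $kS$ on $kQ_1$ are the restrictions of the multiplication of $kQ$ to $kQ_0\otimes kQ_1$ and $kQ_1\otimes kQ_0$. -/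

import Mathlib

open scoped TensorProduct

universe w u v

noncomputable section

namespace QuiverBialgebra

/-! ### Bialgebra structures on a coalgebra -/

section General

variable (k : Type w) [Field k]

/-- A bialgebra structure on a given coalgebra `C` over `k`: an associative unital `k`-algebra
structure on the vector space `C` such that the comultiplication and the counit of `C` are
algebra maps. -/
@[ext]
structure BialgebraStructure (C : Type u) [AddCommGroup C] [Module k C] [Coalgebra k C] where
  /-- the multiplication -/
  mul : C →ₗ[k] C →ₗ[k] C
  /-- the identity element -/
  one : C
  mul_assoc : ∀ x y z, mul (mul x y) z = mul x (mul y z)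
  one_mul : ∀ x, mul one x = x
  mul_one : ∀ x, mul x one = x
  comul_mul : ∀ x y, Coalgebra.comul (R := k) (mul x y) =
    TensorProduct.map₂ mul mul (Coalgebra.comul (R := k) x) (Coalgebra.comul (R := k) y)
  comul_one : Coalgebra.comul (R := k) one = one ⊗ₜ[k] one
  counit_mul : ∀ x y, Coalgebra.counit (R := k) (mul x y) =
    Coalgebra.counit (R := k) x * Coalgebra.counit (R := k) y
  counit_one : Coalgebra.counit (R := k) one = (1 : k)

/-- A `B`-bimodule structure on the vector space `M`. -/
@[ext]
structure BimoduleStructure (B : Type u) [Ring B] [Algebra k B]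
    (M : Type v) [AddCommGroup M] [Module k M] where
  /-- the left action `b ⊗ m ↦ b.m` -/
  lact : B →ₗ[k] M →ₗ[k] M
  /-- the right action `m ⊗ b ↦ m.b` -/
  ract : M →ₗ[k] B →ₗ[k] M
  one_lact : ∀ m, lact 1 m = m
  mul_lact : ∀ b c m, lact (b * c) m = lact b (lact c m)
  ract_one : ∀ m, ract m 1 = m
  ract_mul : ∀ m b c, ract m (b * c) = ract (ract m b) c
  lact_ract : ∀ b m c, ract (lact b m) c = lact b (ract m c)

/-- A `B`-bicomodule structure on the vector space `M`, for a coalgebra `B`. -/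
@[ext]
structure BicomoduleStructure (B : Type u) [AddCommGroup B] [Module k B] [Coalgebra k B]
    (M : Type v) [AddCommGroup M] [Module k M] where
  /-- the left coaction `δ_L` -/
  lcoact : M →ₗ[k] B ⊗[k] M
  /-- the right coaction `δ_R` -/
  rcoact : M →ₗ[k] M ⊗[k] B
  lcoact_coassoc : ∀ m, TensorProduct.assoc k B B M
      ((Coalgebra.comul (R := k) (A := B)).rTensor M (lcoact m)) = lcoact.lTensor B (lcoact m)
  lcoact_counit : ∀ m,
      (Coalgebra.counit (R := k) (A := B)).rTensor M (lcoact m) = (1 : k) ⊗ₜ[k] m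
  rcoact_coassoc : ∀ m, TensorProduct.assoc k M B B (rcoact.rTensor B (rcoact m)) =
      (Coalgebra.comul (R := k) (A := B)).lTensor M (rcoact m)
  rcoact_counit : ∀ m,
      (Coalgebra.counit (R := k) (A := B)).lTensor M (rcoact m) = m ⊗ₜ[k] (1 : k)
  lcoact_rcoact : ∀ m, TensorProduct.assoc k B M B (lcoact.rTensor B (rcoact m)) =
      rcoact.lTensor B (lcoact m)

variable {k}

/-- A bimodule structure and a bicomodule structure over a bialgebra `B` on the same vector space
`M` make `M` a `B`-bialgebra bimodule if both coactions are maps of `B`-bimodules, where `B ⊗ M`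
and `M ⊗ B` carry the diagonal actions
`b.(c ⊗ m) = b₁c ⊗ b₂.m`, `(c ⊗ m).b = cb₁ ⊗ m.b₂`,
`b.(m ⊗ c) = b₁.m ⊗ b₂c`, `(m ⊗ c).b = m.b₁ ⊗ cb₂`. -/
structure IsBialgebraBimodule {B : Type u} [Ring B] [Bialgebra k B]
    {M : Type v} [AddCommGroup M] [Module k M]
    (A : BimoduleStructure k B M) (D : BicomoduleStructure k B M) : Prop where
  lcoact_lact : ∀ b m, D.lcoact (A.lact b m) =
    TensorProduct.map₂ (LinearMap.mul k B) A.lact (Coalgebra.comul (R := k) b) (D.lcoact m)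
  lcoact_ract : ∀ m b, D.lcoact (A.ract m b) =
    TensorProduct.map₂ (LinearMap.mul k B) A.ract (D.lcoact m) (Coalgebra.comul (R := k) b)
  rcoact_lact : ∀ b m, D.rcoact (A.lact b m) =
    TensorProduct.map₂ A.lact (LinearMap.mul k B) (Coalgebra.comul (R := k) b) (D.rcoact m)
  rcoact_ract : ∀ m b, D.rcoact (A.ract m b) =
    TensorProduct.map₂ A.ract (LinearMap.mul k B) (D.rcoact m) (Coalgebra.comul (R := k) b)

end General

/-! ### The path coalgebra -/

/-- The paths of a quiver, with arbitrary source and target. -/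
@[ext]
structure PathOf (V : Type u) [Quiver.{v} V] : Type (max u v) where
  /-- the source -/
  src : V
  /-- the target -/
  tgt : V
  /-- the path -/
  path : Quiver.Path src tgt

/-- The list of all ways to write a path `p` as `p₁` followed by `p₂`; it has one entry for each
vertex along `p`. -/
def splits {V : Type u} [Quiver.{v} V] {a : V} :
    ∀ {b : V}, Quiver.Path a b → List (Σ c : V, Quiver.Path a c × Quiver.Path c b)
  | _, .nil => [⟨a, .nil, .nil⟩]
  | b, .cons p e => ⟨b, p.cons e, .nil⟩ :: (splits p).map fun q => ⟨q.1, q.2.1, q.2.2.cons e⟩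

/-- The path space `kQ`: the vector space with basis the set of all paths. -/
def PathCoalgebra (k : Type w) [Field k] (V : Type u) [Quiver.{v} V] : Type (max w u v) :=
  PathOf V →₀ k

namespace PathCoalgebra

variable (k : Type w) [Field k] (V : Type u) [Quiver.{v} V]

instance : AddCommGroup (PathCoalgebra k V) := inferInstanceAs (AddCommGroup (PathOf V →₀ k))

instance : Module k (PathCoalgebra k V) := inferInstanceAs (Module k (PathOf V →₀ k))

/-- The basis of `kQ` given by the paths. -/
def basis : Module.Basis (PathOf V) k (PathCoalgebra k V) :=
  Module.Basis.ofRepr (LinearEquiv.refl k (PathOf V →₀ k))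

variable {V}

/-- A path, as an element of `kQ`. -/
def ofPath {a b : V} (p : Quiver.Path a b) : PathCoalgebra k V := basis k V ⟨a, b, p⟩

variable (V)

/-- The comultiplication of `kQ`: a path `p` is sent to the sum of `p₂ ⊗ p₁` over all ways to
write `p` as `p₁` followed by `p₂`. -/
def comulMap : PathCoalgebra k V →ₗ[k] PathCoalgebra k V ⊗[k] PathCoalgebra k V :=
  (basis k V).constr k fun p =>
    ((splits p.path).map fun q => ofPath k q.2.2 ⊗ₜ[k] ofPath k q.2.1).sum

/-- The counit of `kQ`: it is `1` on trivial paths and `0` on all other paths. -/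
def counitMap : PathCoalgebra k V →ₗ[k] k :=
  (basis k V).constr k fun p => if p.path.length = 0 then 1 else 0

variable {V}

theorem comulMap_ofPath {a b : V} (p : Quiver.Path a b) :
    comulMap k V (ofPath k p) =
      ((splits p).map fun q => ofPath k q.2.2 ⊗ₜ[k] ofPath k q.2.1).sum := by
  simp [comulMap, ofPath, Module.Basis.constr_basis]

theorem counitMap_ofPath {a b : V} (p : Quiver.Path a b) :
    counitMap k V (ofPath k p) = if p.length = 0 then 1 else 0 := by
  simp [counitMap, ofPath, Module.Basis.constr_basis]

theorem map_list_sum {ι M N : Type*} [AddCommGroup M] [Module k M] [AddCommGroup N] [Module k N]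
    (f : M →ₗ[k] N) (l : List ι) (g : ι → M) :
    f ((l.map g).sum) = (l.map fun i => f (g i)).sum := by
  induction l with
  | nil => simp
  | cons i l ih => simp [ih]

theorem splits_coassoc {A : Type*} [AddCommGroup A] {a b : V} (p : Quiver.Path a b)
    (F : ∀ c d : V, Quiver.Path a c → Quiver.Path c d → Quiver.Path d b → A) :
    ((splits p).map fun q => ((splits q.2.1).map fun r => F _ _ r.2.1 r.2.2 q.2.2).sum).sum =
    ((splits p).map fun q => ((splits q.2.2).map fun r => F _ _ q.2.1 r.2.1 r.2.2).sum).sum := by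
  induction p with
  | nil => simp [splits]
  | cons p e ih =>
    have h := ih fun c d x y z => F c d x y (z.cons e)
    simp only [splits, List.map_cons, List.sum_cons, List.map_map, Function.comp_def,
      List.map_nil, List.sum_nil, add_zero] at h ⊢
    rw [h, List.sum_map_add, add_assoc]

theorem splits_counit_left {A : Type*} [AddCommGroup A] [Module k A] {a b : V}
    (p : Quiver.Path a b) (F : ∀ c : V, Quiver.Path a c → Quiver.Path c b → A) :
    ((splits p).map fun q =>
      (if q.2.2.length = 0 then (1 : k) else 0) • F _ q.2.1 q.2.2).sum = F _ p .nil := by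
  cases p with
  | nil => simp [splits]
  | cons p e => simp [splits, Function.comp_def]

theorem splits_counit_right {A : Type*} [AddCommGroup A] [Module k A] {a b : V}
    (p : Quiver.Path a b) (F : ∀ c : V, Quiver.Path a c → Quiver.Path c b → A) :
    ((splits p).map fun q =>
      (if q.2.1.length = 0 then (1 : k) else 0) • F _ q.2.1 q.2.2).sum = F _ .nil p := by
  induction p with
  | nil => simp [splits]
  | cons p e ih =>
    have h := ih fun c x y => F c x (y.cons e)
    simpa [splits, Function.comp_def] using h

/-- The path coalgebra of a quiver. -/
instance : Coalgebra k (PathCoalgebra k V) where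
  comul := comulMap k V
  counit := counitMap k V
  coassoc := by
    refine (basis k V).ext fun p => ?_
    change TensorProduct.assoc k _ _ _ ((comulMap k V).rTensor _ (comulMap k V (ofPath k p.path)))
      = (comulMap k V).lTensor _ (comulMap k V (ofPath k p.path))
    have h := splits_coassoc p.path fun c d x y z =>
      ofPath k z ⊗ₜ[k] (ofPath k y ⊗ₜ[k] ofPath k x)
    simp only [comulMap_ofPath, map_list_sum, LinearMap.rTensor_tmul, LinearMap.lTensor_tmul]
    rw [← LinearEquiv.coe_coe, map_list_sum]
    have e1 : ∀ {x y : V} (p : Quiver.Path x y) (m : PathCoalgebra k V),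
        (TensorProduct.assoc k _ _ _).toLinearMap
          (((splits p).map fun q => ofPath k q.2.2 ⊗ₜ[k] ofPath k q.2.1).sum ⊗ₜ[k] m) =
        ((splits p).map fun q => ofPath k q.2.2 ⊗ₜ[k] (ofPath k q.2.1 ⊗ₜ[k] m)).sum := by
      intro x y p m
      have := map_list_sum k ((TensorProduct.assoc k _ _ _).toLinearMap ∘ₗ
        (TensorProduct.mk k _ (PathCoalgebra k V)).flip m) (splits p)
        fun q => ofPath k q.2.2 ⊗ₜ[k] ofPath k q.2.1
      simpa using this
    have e2 : ∀ {x y : V} (p : Quiver.Path x y) (m : PathCoalgebra k V),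
        m ⊗ₜ[k] ((splits p).map fun q => ofPath k q.2.2 ⊗ₜ[k] ofPath k q.2.1).sum =
        ((splits p).map fun q => m ⊗ₜ[k] (ofPath k q.2.2 ⊗ₜ[k] ofPath k q.2.1)).sum := by
      intro x y p m
      exact map_list_sum k (TensorProduct.mk k (PathCoalgebra k V) _ m) (splits p) _
    simp only [e1, e2]
    exact h.symm
  rTensor_counit_comp_comul := by
    refine (basis k V).ext fun p => ?_
    change (counitMap k V).rTensor _ (comulMap k V (ofPath k p.path)) = 1 ⊗ₜ[k] ofPath k p.path
    have h := splits_counit_left k p.path fun c x y => (1 : k) ⊗ₜ[k] ofPath k x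
    simp only [comulMap_ofPath, map_list_sum, LinearMap.rTensor_tmul, counitMap_ofPath]
    rw [← h]
    simp only [TensorProduct.smul_tmul', smul_eq_mul, mul_one]
  lTensor_counit_comp_comul := by
    refine (basis k V).ext fun p => ?_
    change (counitMap k V).lTensor _ (comulMap k V (ofPath k p.path)) = ofPath k p.path ⊗ₜ[k] 1
    have h := splits_counit_right k p.path fun c x y => ofPath k y ⊗ₜ[k] (1 : k)
    simp only [comulMap_ofPath, map_list_sum, LinearMap.lTensor_tmul, counitMap_ofPath]
    rw [← h]
    simp only [← TensorProduct.tmul_smul, smul_eq_mul, mul_one]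

variable (V)

/-- The subspace `kQ_n` of `kQ` spanned by the paths of length `n`. -/
def component (n : ℕ) : Submodule k (PathCoalgebra k V) :=
  Submodule.span k {x | ∃ (a b : V) (p : Quiver.Path a b), p.length = n ∧ x = ofPath k p}

/-- The space `kQ_1` with basis the set of all arrows. -/
abbrev ArrowSpace : Type (max w u v) := Quiver.Total V →₀ k

/-- The inclusion of `kQ_0` in `kQ`; a vertex is sent to the trivial path at it. -/
def vertexIncl : MonoidAlgebra k V →ₗ[k] PathCoalgebra k V :=
  (Finsupp.lift (PathCoalgebra k V) k V fun g => ofPath k (Quiver.Path.nil : Quiver.Path g g)) ∘ₗ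
    (MonoidAlgebra.coeffLinearEquiv k).toLinearMap

/-- The inclusion of `kQ_1` in `kQ`; an arrow is sent to the path of length one given by it. -/
def arrowIncl : ArrowSpace k V →ₗ[k] PathCoalgebra k V :=
  Finsupp.lift (PathCoalgebra k V) k (Quiver.Total V) fun e => ofPath k e.hom.toPath

end PathCoalgebra

open PathCoalgebra

variable (k : Type w) [Field k] (V : Type u) [Quiver.{v} V]

/-- The `kQ_0`-bicomodule structure of `kQ_1`: `δ_L(a) = t(a) ⊗ a` and `δ_R(a) = a ⊗ s(a)` for
every arrow `a`. Here `kQ_0` is the coalgebra with basis the vertices, all of them group-like. -/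
def arrowBicomodule : BicomoduleStructure k (MonoidAlgebra k V) (ArrowSpace k V) where
  lcoact := Finsupp.lift _ k (Quiver.Total V) fun e =>
    MonoidAlgebra.single e.right (1 : k) ⊗ₜ[k] Finsupp.single e (1 : k)
  rcoact := Finsupp.lift _ k (Quiver.Total V) fun e =>
    Finsupp.single e (1 : k) ⊗ₜ[k] MonoidAlgebra.single e.left (1 : k)
  lcoact_coassoc m := by
    induction m using Finsupp.induction_linear with
    | zero => simp
    | add x y hx hy => simp only [map_add, hx, hy]
    | single e c => simp
  lcoact_counit m := by
    induction m using Finsupp.induction_linear with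
    | zero => simp
    | add x y hx hy => simp only [map_add, hx, hy, TensorProduct.tmul_add]
    | single e c => simp [← TensorProduct.tmul_smul]
  rcoact_coassoc m := by
    induction m using Finsupp.induction_linear with
    | zero => simp
    | add x y hx hy => simp only [map_add, hx, hy]
    | single e c => simp
  rcoact_counit m := by
    induction m using Finsupp.induction_linear with
    | zero => simp
    | add x y hx hy => simp only [map_add, hx, hy, TensorProduct.add_tmul]
    | single e c => simp [TensorProduct.smul_tmul']
  lcoact_rcoact m := by
    induction m using Finsupp.induction_linear with
    | zero => simp
    | add x y hx hy => simp only [map_add, hx, hy]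
    | single e c => simp

/-- For a monoid structure `S` on the set of vertices, the set of `kS`-bialgebra bimodule
structures on `kQ_1`, whose bicomodule structure is the one given by the quiver. -/
def ArrowBialgebraBimodule (S : Monoid V) : Type (max w u v) :=
  {A : BimoduleStructure k (MonoidAlgebra k V) (ArrowSpace k V) //
    IsBialgebraBimodule A (arrowBicomodule k V)}

variable {k V}

/-- A bialgebra structure on `kQ` is graded if its multiplication and its unit respect the
gradation by the length of paths. (The comultiplication and the counit of `kQ` always do.) -/
structure BialgebraStructure.IsGraded (H : BialgebraStructure k (PathCoalgebra k V)) : Prop where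
  one_mem : H.one ∈ component k V 0
  mul_mem : ∀ (m n : ℕ) (x y : PathCoalgebra k V),
    x ∈ component k V m → y ∈ component k V n → H.mul x y ∈ component k V (m + n)

/-- The multiplication of `H` restricts to the multiplication of `kS` on `kQ_0`, and to the left
and the right action of `kS` on `kQ_1`. -/
structure BialgebraStructure.RestrictsTo (H : BialgebraStructure k (PathCoalgebra k V))
    (S : Monoid V) (A : ArrowBialgebraBimodule k V S) : Prop where
  one_eq : H.one = vertexIncl k V 1
  mul_vertex : ∀ b c : MonoidAlgebra k V,
    H.mul (vertexIncl k V b) (vertexIncl k V c) = vertexIncl k V (b * c)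
  mul_left : ∀ (b : MonoidAlgebra k V) (m : ArrowSpace k V),
    H.mul (vertexIncl k V b) (arrowIncl k V m) = arrowIncl k V (A.1.lact b m)
  mul_right : ∀ (m : ArrowSpace k V) (b : MonoidAlgebra k V),
    H.mul (arrowIncl k V m) (vertexIncl k V b) = arrowIncl k V (A.1.ract m b)

end QuiverBialgebra

end

/-!
The dual space `(kQ)^*` is an algebra under convolution, and in it the coordinate functionals of the
paths multiply like paths: they concatenate, or give zero if the paths do not compose
(`isPathSystem_coeff`). Hence a comultiplicative linear map `f : C → kQ` from a coalgebra `C` is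
determined by its components `f₀ : C → kQ_0` and `f₁ : C → kQ_1` (`hom_ext_proj`): its coordinate at
a path is the convolution product of its coordinates at the arrows of the path. Conversely, if `f₀` is
comultiplicative and `f₁` is compatible with the coactions along `f₀`, then the products of
coordinates define a comultiplicative map, provided that only finitely many of them are nonzero at
each `c ∈ C` (`stage`, `isPathSystem_of_stage`).

From a pair `(S, M)` the multiplication of `kQ` is the map on `C = kQ ⊗ kQ` with components
`x ⊗ y ↦ π₀(x) π₀(y)` and `x ⊗ y ↦ π₀(x).π₁(y) + π₁(x).π₀(y)`. Compatibility with the coactions is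
exactly the condition that `M` is a bialgebra bimodule, finiteness follows from the gradation
(`stage_tmul_of_ne`), and associativity and the unit laws are equalities of comultiplicative maps,
hence can be checked on the components in `kQ_0` and `kQ_1`. The same uniqueness shows that every
graded bialgebra structure which restricts to `(S, M)` is this one (`eq_bialgebraOfBimodule`).

From an arbitrary bialgebra structure on `kQ`, the monoid arises because the group-like elements of
`kQ` are the vertices (`exists_eq_vertex`). The product of a vertex and an arrow is skew-primitive
and so lies in `kQ_0 + kQ_1` (`eq_incl_add_incl_of_comul`); as `kQ_0` is closed under multiplication,
projecting such products to `kQ_1` gives a bimodule, and the projection of the comultiplication to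
`kQ_0 ⊗ kQ_1` and `kQ_1 ⊗ kQ_0` shows that it is a bialgebra bimodule.
-/

noncomputable section

namespace QuiverBialgebra

open PathCoalgebra

/-! ### Convolution of functionals on a coalgebra -/

section Convolution

variable {k : Type*} [Field k] {C : Type*} [AddCommGroup C] [Module k C] [Coalgebra k C]
  {D : Type*} [AddCommGroup D] [Module k D] [Coalgebra k D]

/-- The convolution product `c ↦ ∑ φ(c₁) ψ(c₂)` of two linear functionals on a coalgebra. -/
def conv (φ ψ : C →ₗ[k] k) : C →ₗ[k] k :=
  LinearMap.mul' k k ∘ₗ TensorProduct.map φ ψ ∘ₗ Coalgebra.comul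

theorem conv_assoc (φ ψ χ : C →ₗ[k] k) : conv (conv φ ψ) χ = conv φ (conv ψ χ) :=
  congrArg WithConv.ofConv
    (mul_assoc (WithConv.toConv φ) (WithConv.toConv ψ) (WithConv.toConv χ))

@[simp]
theorem conv_zero (φ : C →ₗ[k] k) : conv φ 0 = 0 := by simp [conv]

@[simp]
theorem zero_conv (φ : C →ₗ[k] k) : conv 0 φ = 0 := by simp [conv]

/-- A comultiplicative map of coalgebras induces a multiplicative map on functionals. -/
theorem conv_comp {h : D →ₗ[k] C}
    (hh : TensorProduct.map h h ∘ₗ Coalgebra.comul = Coalgebra.comul ∘ₗ h) (φ ψ : C →ₗ[k] k) :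
    conv φ ψ ∘ₗ h = conv (φ ∘ₗ h) (ψ ∘ₗ h) := by
  rw [conv, conv, TensorProduct.map_comp, LinearMap.comp_assoc, LinearMap.comp_assoc,
    LinearMap.comp_assoc, ← hh]

end Convolution

/-! ### Coordinates on the path coalgebra -/

/-- Two linear maps on a monoid algebra agree if they agree on the basis elements. -/
theorem vertex_hom_ext {k X N : Type*} [Field k] [AddCommMonoid N] [Module k N]
    {f g : MonoidAlgebra k X →ₗ[k] N}
    (h : ∀ x : X, f (MonoidAlgebra.single x 1) = g (MonoidAlgebra.single x 1)) : f = g := by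
  refine LinearMap.ext fun x => ?_
  induction x using MonoidAlgebra.induction_linear with
  | zero => simp
  | add x y hx hy => simp [hx, hy]
  | single x c =>
    have : MonoidAlgebra.single x c = c • MonoidAlgebra.single x (1 : k) := by simp
    rw [this, map_smul, map_smul, h]

section Coordinates

variable {k : Type w} [Field k] {V : Type u} [Quiver.{v} V]

/-- The trivial path at a vertex. -/
def PathOf.nil (g : V) : PathOf V := ⟨g, g, .nil⟩

/-- An arrow, as a path of length one. -/
def PathOf.arrow (e : Quiver.Total V) : PathOf V := ⟨e.left, e.right, e.hom.toPath⟩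

theorem PathOf.nil_injective : Function.Injective (PathOf.nil : V → PathOf V) :=
  fun _ _ h => congrArg PathOf.src h

theorem PathOf.mk_eq_nil {a b : V} (p : Quiver.Path a b) (g : V) :
    (⟨a, b, p⟩ : PathOf V) = PathOf.nil g ↔ p.length = 0 ∧ b = g := by
  constructor
  · intro h
    obtain ⟨rfl, h1⟩ := (PathOf.mk.injEq ..).mp h
    obtain ⟨rfl, h2⟩ := h1
    obtain rfl := eq_of_heq h2
    simp
  · rintro ⟨h, rfl⟩
    cases p with
    | nil => rfl
    | cons p e => simp at h

theorem PathOf.mk_cons_eq {a b c a' b' c' : V} (p : Quiver.Path a b) (e : b ⟶ c)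
    (p' : Quiver.Path a' b') (e' : b' ⟶ c') :
    (⟨a, c, p.cons e⟩ : PathOf V) = ⟨a', c', p'.cons e'⟩ ↔
      (⟨a, b, p⟩ : PathOf V) = ⟨a', b', p'⟩ ∧
        (⟨b, c, e⟩ : Quiver.Total V) = ⟨b', c', e'⟩ := by
  constructor
  · intro h
    obtain ⟨rfl, h1⟩ := (PathOf.mk.injEq ..).mp h
    obtain ⟨rfl, h2⟩ := h1
    have h2 := eq_of_heq h2
    obtain rfl := Quiver.Path.obj_eq_of_cons_eq_cons h2
    have h3 := eq_of_heq (Quiver.Path.heq_of_cons_eq_cons h2)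
    have h4 := eq_of_heq (Quiver.Path.hom_heq_of_cons_eq_cons h2)
    subst h3 h4
    simp
  · rintro ⟨h, h'⟩
    obtain ⟨rfl, h1⟩ := (PathOf.mk.injEq ..).mp h
    obtain ⟨rfl, h2⟩ := h1
    obtain rfl := eq_of_heq h2
    obtain ⟨-, h1⟩ := (Quiver.Total.mk.injEq ..).mp h'
    obtain ⟨rfl, h2⟩ := h1
    obtain rfl := eq_of_heq h2
    rfl

theorem PathOf.mk_cons_eq_arrow {a b c : V} (p : Quiver.Path a b) (e : b ⟶ c)
    (e' : Quiver.Total V) : (⟨a, c, p.cons e⟩ : PathOf V) = PathOf.arrow e' ↔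
      p.length = 0 ∧ (⟨b, c, e⟩ : Quiver.Total V) = e' := by
  obtain ⟨l, r, e'⟩ := e'
  refine (PathOf.mk_cons_eq p e .nil e').trans ?_
  refine (and_congr_left ?_)
  intro h
  have hb : b = l := congrArg Quiver.Total.left h
  have := PathOf.mk_eq_nil p l
  simp only [hb, and_true] at this
  rw [PathOf.nil] at this
  exact this

theorem PathOf.arrow_injective : Function.Injective (PathOf.arrow : Quiver.Total V → PathOf V) :=
  fun e e' h => ((PathOf.mk_cons_eq_arrow .nil e.hom e').mp h).2

/-- The coefficient of a path `p` in an element of `kQ`. -/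
def coeff (p : PathOf V) : PathCoalgebra k V →ₗ[k] k := (basis k V).coord p

open scoped Classical in
theorem coeff_ofPath (p : PathOf V) {a b : V} (q : Quiver.Path a b) :
    coeff p (ofPath k q) = if (⟨a, b, q⟩ : PathOf V) = p then 1 else 0 := by
  simp [coeff, ofPath, Module.Basis.coord_apply, Finsupp.single_apply]

theorem ext_coeff {x y : PathCoalgebra k V} (h : ∀ p, coeff p x = coeff p y) : x = y :=
  (basis k V).ext_elem h

theorem hom_ext_coeff {N : Type*} [AddCommGroup N] [Module k N] {f g : N →ₗ[k] PathCoalgebra k V}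
    (h : ∀ p, coeff p ∘ₗ f = coeff p ∘ₗ g) : f = g :=
  LinearMap.ext fun x => ext_coeff fun p => LinearMap.congr_fun (h p) x

theorem hom_ext_ofPath {N : Type*} [AddCommMonoid N] [Module k N]
    {f g : PathCoalgebra k V →ₗ[k] N}
    (h : ∀ (a b : V) (p : Quiver.Path a b), f (ofPath k p) = g (ofPath k p)) : f = g :=
  (basis k V).ext fun p => h _ _ p.path

theorem comul_ofPath {a b : V} (p : Quiver.Path a b) :
    Coalgebra.comul (R := k) (ofPath k p) =
      ((splits p).map fun q => ofPath k q.2.2 ⊗ₜ[k] ofPath k q.2.1).sum :=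
  comulMap_ofPath k p

theorem conv_ofPath (φ ψ : PathCoalgebra k V →ₗ[k] k) {a b : V} (p : Quiver.Path a b) :
    conv φ ψ (ofPath k p) =
      ((splits p).map fun q => φ (ofPath k q.2.2) * ψ (ofPath k q.2.1)).sum := by
  simp only [conv, LinearMap.comp_apply, comul_ofPath]
  rw [map_list_sum, map_list_sum]
  simp

/-- Two elements of `kQ ⊗ kQ` agree if they have the same coordinates in the basis of pairs of
paths. -/
theorem tensor_ext_coeff {x y : PathCoalgebra k V ⊗[k] PathCoalgebra k V}
    (h : ∀ p q, LinearMap.mul' k k (TensorProduct.map (coeff p) (coeff q) x) =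
      LinearMap.mul' k k (TensorProduct.map (coeff p) (coeff q) y)) : x = y := by
  refine ((basis k V).tensorProduct (basis k V)).ext_elem fun ⟨i, j⟩ => ?_
  have key : ∀ z : PathCoalgebra k V ⊗[k] PathCoalgebra k V,
      ((basis k V).tensorProduct (basis k V)).repr z (i, j) =
        LinearMap.mul' k k (TensorProduct.map (coeff i) (coeff j) z) := by
    intro z
    induction z with
    | zero => simp
    | add a b ha hb => simp [ha, hb]
    | tmul a b =>
      simp [coeff, Module.Basis.tensorProduct_repr_tmul_apply, mul_comm]
  rw [key, key, h]

/-! ### Projections to vertices and arrows -/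

/-- The projection of `kQ` onto `kQ_0`. -/
def vertexProj : PathCoalgebra k V →ₗ[k] MonoidAlgebra k V :=
  (MonoidAlgebra.coeffLinearEquiv k).symm.toLinearMap ∘ₗ
    Finsupp.lcomapDomain PathOf.nil PathOf.nil_injective ∘ₗ (basis k V).repr.toLinearMap

/-- The projection of `kQ` onto `kQ_1`. -/
def arrowProj : PathCoalgebra k V →ₗ[k] ArrowSpace k V :=
  Finsupp.lcomapDomain PathOf.arrow PathOf.arrow_injective ∘ₗ (basis k V).repr.toLinearMap

theorem vertexProj_coeff (x : PathCoalgebra k V) (g : V) :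
    (vertexProj x).coeff g = coeff (PathOf.nil g) x := rfl

theorem arrowProj_apply (x : PathCoalgebra k V) (e : Quiver.Total V) :
    arrowProj x e = coeff (PathOf.arrow e) x := rfl

theorem vertexProj_ofPath {a b : V} (p : Quiver.Path a b) :
    vertexProj (ofPath k p) =
      (if p.length = 0 then (1 : k) else 0) • MonoidAlgebra.single b (1 : k) := by
  classical
  apply MonoidAlgebra.coeff_injective
  ext g
  rw [vertexProj_coeff, coeff_ofPath, MonoidAlgebra.coeff_smul_apply, MonoidAlgebra.coeff_single,
    Finsupp.single_apply]
  by_cases h : p.length = 0 <;> simp [PathOf.mk_eq_nil, h]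

theorem vertexProj_ofPath' {a b : V} (p : Quiver.Path a b) :
    vertexProj (ofPath k p) =
      (if p.length = 0 then (1 : k) else 0) • MonoidAlgebra.single a (1 : k) := by
  rw [vertexProj_ofPath]
  cases p <;> simp

@[simp]
theorem vertexProj_nil (g : V) :
    vertexProj (ofPath k (Quiver.Path.nil : Quiver.Path g g)) = MonoidAlgebra.single g 1 := by
  simp [vertexProj_ofPath]

@[simp]
theorem vertexProj_cons {a b c : V} (p : Quiver.Path a b) (e : b ⟶ c) :
    vertexProj (ofPath k (p.cons e)) = 0 := by
  simp [vertexProj_ofPath]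

@[simp]
theorem arrowProj_nil (g : V) :
    arrowProj (ofPath k (Quiver.Path.nil : Quiver.Path g g)) = 0 := by
  classical
  ext e
  rw [arrowProj_apply, coeff_ofPath, if_neg]
  · rfl
  · intro h
    have := (PathOf.mk_eq_nil e.hom.toPath g).mp h.symm
    simp at this

theorem arrowProj_cons {a b c : V} (p : Quiver.Path a b) (e : b ⟶ c) :
    arrowProj (ofPath k (p.cons e)) =
      (if p.length = 0 then (1 : k) else 0) • Finsupp.single ⟨b, c, e⟩ (1 : k) := by
  classical
  ext e'
  rw [arrowProj_apply, coeff_ofPath, Finsupp.smul_apply, Finsupp.single_apply]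
  simp only [PathOf.mk_cons_eq_arrow, ite_and, smul_eq_mul, ite_mul, one_mul, zero_mul]

theorem vertexIncl_single (g : V) (c : k) :
    vertexIncl k V (MonoidAlgebra.single g c) =
      c • ofPath k (Quiver.Path.nil : Quiver.Path g g) := by
  simp [vertexIncl]

theorem arrowIncl_single (e : Quiver.Total V) (c : k) :
    arrowIncl k V (Finsupp.single e c) = c • ofPath k e.hom.toPath := by
  simp [arrowIncl]

/-- Two linear maps on `kQ_1` agree if they agree on the arrows. -/
theorem arrow_hom_ext {N : Type*} [AddCommMonoid N] [Module k N] {f g : ArrowSpace k V →ₗ[k] N}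
    (h : ∀ e : Quiver.Total V, f (Finsupp.single e 1) = g (Finsupp.single e 1)) : f = g :=
  Finsupp.lhom_ext' fun e => LinearMap.ext_ring (h e)

@[simp]
theorem vertexProj_vertexIncl (b : MonoidAlgebra k V) : vertexProj (vertexIncl k V b) = b :=
  LinearMap.congr_fun (f := vertexProj ∘ₗ vertexIncl k V) (g := LinearMap.id)
    (vertex_hom_ext fun x => by simp [vertexIncl_single]) b

@[simp]
theorem arrowProj_vertexIncl (b : MonoidAlgebra k V) : arrowProj (vertexIncl k V b) = 0 :=
  LinearMap.congr_fun (f := arrowProj ∘ₗ vertexIncl k V) (g := 0)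
    (vertex_hom_ext fun x => by simp [vertexIncl_single]) b

@[simp]
theorem vertexProj_arrowIncl (m : ArrowSpace k V) : vertexProj (arrowIncl k V m) = 0 :=
  LinearMap.congr_fun (f := vertexProj ∘ₗ arrowIncl k V) (g := 0)
    (arrow_hom_ext fun x => by simp [arrowIncl_single, Quiver.Hom.toPath]) m

@[simp]
theorem arrowProj_arrowIncl (m : ArrowSpace k V) : arrowProj (arrowIncl k V m) = m :=
  LinearMap.congr_fun (f := arrowProj ∘ₗ arrowIncl k V) (g := LinearMap.id)
    (arrow_hom_ext fun x => by simp [arrowIncl_single, Quiver.Hom.toPath, arrowProj_cons]) m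

theorem vertexIncl_injective : Function.Injective (vertexIncl k V) :=
  Function.LeftInverse.injective vertexProj_vertexIncl

theorem arrowIncl_injective : Function.Injective (arrowIncl k V) :=
  Function.LeftInverse.injective arrowProj_arrowIncl

/-- The image of `Δ(p)` under `π₀ ⊗ F`: only the term `t(p) ⊗ p` survives. -/
theorem map_vertexProj_comul {N : Type*} [AddCommGroup N] [Module k N]
    (F : PathCoalgebra k V →ₗ[k] N) {a b : V} (p : Quiver.Path a b) :
    TensorProduct.map vertexProj F (Coalgebra.comul (R := k) (ofPath k p)) =
      MonoidAlgebra.single b (1 : k) ⊗ₜ[k] F (ofPath k p) := by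
  rw [comul_ofPath, map_list_sum, ← splits_counit_left k p fun c x y =>
    MonoidAlgebra.single b (1 : k) ⊗ₜ[k] F (ofPath k x)]
  simp only [TensorProduct.map_tmul, vertexProj_ofPath, TensorProduct.smul_tmul']

/-- The image of `Δ(p)` under `F ⊗ π₀`: only the term `p ⊗ s(p)` survives. -/
theorem map_comul_vertexProj {N : Type*} [AddCommGroup N] [Module k N]
    (F : PathCoalgebra k V →ₗ[k] N) {a b : V} (p : Quiver.Path a b) :
    TensorProduct.map F vertexProj (Coalgebra.comul (R := k) (ofPath k p)) =
      F (ofPath k p) ⊗ₜ[k] MonoidAlgebra.single a (1 : k) := by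
  rw [comul_ofPath, map_list_sum, ← splits_counit_right k p fun c x y =>
    F (ofPath k y) ⊗ₜ[k] MonoidAlgebra.single a (1 : k)]
  simp only [TensorProduct.map_tmul, vertexProj_ofPath', TensorProduct.tmul_smul]

end Coordinates

section Systems

variable {k : Type w} [Field k] {V : Type u} [Quiver.{v} V]
  {C : Type*} [AddCommGroup C] [Module k C] [Coalgebra k C]

/-! ### The multiplication of coordinates -/

open scoped Classical in
/-- A family of functionals on a coalgebra, indexed by the paths, such that the functionals of
vertices and arrows multiply under convolution like vertices and arrows in the path algebra, and
the functional of a path is the product of those of its arrows. -/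
structure IsPathSystem (φ : PathOf V → C →ₗ[k] k) : Prop where
  vertex_vertex : ∀ g h : V, conv (φ (.nil g)) (φ (.nil h)) = if h = g then φ (.nil h) else 0
  vertex_arrow : ∀ (g : V) (e : Quiver.Total V),
    conv (φ (.nil g)) (φ (.arrow e)) = if e.right = g then φ (.arrow e) else 0
  arrow_vertex : ∀ (e : Quiver.Total V) (g : V),
    conv (φ (.arrow e)) (φ (.nil g)) = if e.left = g then φ (.arrow e) else 0
  arrow_path : ∀ {a b c : V} (p : Quiver.Path a b) (e : b ⟶ c),
    conv (φ (.arrow ⟨b, c, e⟩)) (φ ⟨a, b, p⟩) = φ ⟨a, c, p.cons e⟩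

namespace IsPathSystem

variable {φ : PathOf V → C →ₗ[k] k}

open scoped Classical in
theorem vertex_path (hφ : IsPathSystem φ) (g : V) {a b : V} (p : Quiver.Path a b) :
    conv (φ (.nil g)) (φ ⟨a, b, p⟩) = if b = g then φ ⟨a, b, p⟩ else 0 := by
  cases p with
  | nil => exact hφ.vertex_vertex g a
  | cons p e =>
    rw [← hφ.arrow_path, ← conv_assoc, hφ.vertex_arrow]
    split_ifs <;> simp

/-- The whole family multiplies like the basis of the path algebra: by concatenation, and (see
`path_path_of_ne`) with zero products of paths that do not compose. -/
theorem path_path (hφ : IsPathSystem φ) {a b c : V} (p : Quiver.Path a b) (q : Quiver.Path b c) :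
    conv (φ ⟨b, c, q⟩) (φ ⟨a, b, p⟩) = φ ⟨a, c, p.comp q⟩ := by
  induction q with
  | nil => exact (hφ.vertex_path b p).trans (if_pos rfl)
  | cons q e ih => rw [← hφ.arrow_path, conv_assoc, ih, hφ.arrow_path, Quiver.Path.comp_cons]

theorem path_path_of_ne (hφ : IsPathSystem φ) {a b b' c : V} (p : Quiver.Path a b)
    (q : Quiver.Path b' c)
    (h : b ≠ b') : conv (φ ⟨b', c, q⟩) (φ ⟨a, b, p⟩) = 0 := by
  induction q with
  | nil => exact (hφ.vertex_path b' p).trans (if_neg h)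
  | cons q e ih => rw [← hφ.arrow_path, conv_assoc, ih, conv_zero]

end IsPathSystem

/-- The coordinate functional of a monoid algebra at a basis element; on `kQ_0`, the coordinate at
a vertex. -/
def vertexCoord {k X : Type*} [Field k] (g : X) : MonoidAlgebra k X →ₗ[k] k :=
  Finsupp.lapply g ∘ₗ (MonoidAlgebra.coeffLinearEquiv k).toLinearMap

theorem coeff_nil_eq (g : V) :
    (coeff (PathOf.nil g) : PathCoalgebra k V →ₗ[k] k) = vertexCoord g ∘ₗ vertexProj := rfl

theorem coeff_arrow_eq (e : Quiver.Total V) :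
    (coeff (PathOf.arrow e) : PathCoalgebra k V →ₗ[k] k) = Finsupp.lapply e ∘ₗ arrowProj := rfl

open scoped Classical in
theorem vertexCoord_single {k X : Type*} [Field k] (g h : X) :
    vertexCoord g (MonoidAlgebra.single h (1 : k)) = if h = g then 1 else 0 := by
  simp [vertexCoord, Finsupp.single_apply]

open scoped Classical in
theorem conv_vertex_coeff (g : V) (ψ : PathCoalgebra k V →ₗ[k] k) {a b : V}
    (p : Quiver.Path a b) :
    conv (coeff (.nil g)) ψ (ofPath k p) = if b = g then ψ (ofPath k p) else 0 := by
  have := congrArg (LinearMap.mul' k k ∘ₗ TensorProduct.map (vertexCoord g) LinearMap.id)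
    (map_vertexProj_comul ψ p)
  rw [LinearMap.comp_apply, ← LinearMap.comp_apply (TensorProduct.map _ _),
    ← TensorProduct.map_comp] at this
  simpa [vertexCoord_single, conv, coeff_nil_eq] using this

open scoped Classical in
theorem conv_coeff_vertex (g : V) (ψ : PathCoalgebra k V →ₗ[k] k) {a b : V}
    (p : Quiver.Path a b) :
    conv ψ (coeff (.nil g)) (ofPath k p) = if a = g then ψ (ofPath k p) else 0 := by
  have := congrArg (LinearMap.mul' k k ∘ₗ TensorProduct.map LinearMap.id (vertexCoord g))
    (map_comul_vertexProj ψ p)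
  rw [LinearMap.comp_apply, ← LinearMap.comp_apply (TensorProduct.map _ _),
    ← TensorProduct.map_comp] at this
  simpa [vertexCoord_single, conv, coeff_nil_eq] using this

/-- The coordinates of `kQ` are dual to its basis, so their convolution is the product of the path
algebra. -/
theorem isPathSystem_coeff :
    IsPathSystem (coeff : PathOf V → PathCoalgebra k V →ₗ[k] k) := by
  classical
  have hL : ∀ (g : V) (p : PathOf V), conv (coeff (.nil g)) (coeff p) =
      if p.tgt = g then (coeff p : PathCoalgebra k V →ₗ[k] k) else 0 := by
    intro g p
    refine hom_ext_ofPath fun a b q => ?_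
    rw [conv_vertex_coeff]
    by_cases h : (⟨a, b, q⟩ : PathOf V) = p
    · subst h
      split_ifs <;> simp
    · have : coeff p (ofPath k q) = 0 := by rw [coeff_ofPath, if_neg h]
      split_ifs <;> simp [this]
  have hR : ∀ (g : V) (p : PathOf V), conv (coeff p) (coeff (.nil g)) =
      if p.src = g then (coeff p : PathCoalgebra k V →ₗ[k] k) else 0 := by
    intro g p
    refine hom_ext_ofPath fun a b q => ?_
    rw [conv_coeff_vertex]
    by_cases h : (⟨a, b, q⟩ : PathOf V) = p
    · subst h
      split_ifs <;> simp
    · have : coeff p (ofPath k q) = 0 := by rw [coeff_ofPath, if_neg h]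
      split_ifs <;> simp [this]
  refine ⟨fun g h => hL g _, fun g e => hL g _, fun e g => hR g _, ?_⟩
  intro a b c p e
  -- Among the splittings of `q`, only the one that cuts off the last arrow pairs with `e` and `p`.
  refine hom_ext_ofPath fun a' c' q => ?_
  rw [conv_ofPath, coeff_ofPath]
  cases q with
  | nil =>
    rw [if_neg]
    · have : coeff (.arrow ⟨b, c, e⟩) (ofPath k (Quiver.Path.nil : Quiver.Path a' a')) = 0 :=
        DFunLike.congr_fun (arrowProj_nil a') _
      simp [splits, this]
    · intro h
      have := (PathOf.mk_eq_nil (p.cons e) a').mp h.symm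
      simp at this
  | @cons b' _ q e' =>
    have key : ∀ {d : V} (y : Quiver.Path d b'),
        coeff (.arrow ⟨b, c, e⟩) (ofPath k (y.cons e')) = (if y.length = 0 then (1 : k) else 0) *
          if (⟨b', c', e'⟩ : Quiver.Total V) = ⟨b, c, e⟩ then 1 else 0 := by
      intro d y
      rw [coeff_ofPath, PathOf.mk_cons_eq_arrow, ite_zero_mul_ite_zero, one_mul]
      congr
    have h0 : coeff (.arrow ⟨b, c, e⟩) (ofPath k (Quiver.Path.nil : Quiver.Path c' c')) = (0 : k) :=
      DFunLike.congr_fun (arrowProj_nil c') _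
    have h1 := splits_counit_left k q fun d x y =>
      (if (⟨b', c', e'⟩ : Quiver.Total V) = ⟨b, c, e⟩ then (1 : k) else 0) *
        coeff ⟨a, b, p⟩ (ofPath k x)
    simp only [smul_eq_mul] at h1
    simp only [splits, List.map_cons, List.sum_cons, List.map_map, Function.comp_def, h0, key,
      zero_mul, zero_add, mul_assoc, h1]
    rw [coeff_ofPath, PathOf.mk_cons_eq, ite_zero_mul_ite_zero, one_mul]
    simp only [and_comm]

/-! ### Maps into the path coalgebra that respect comultiplication -/

/-- A linear map into `kQ` respects comultiplication if its coordinates form a path system. -/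
theorem IsPathSystem.map_comp_comul {f : C →ₗ[k] PathCoalgebra k V}
    (hf : IsPathSystem fun p => coeff p ∘ₗ f) :
    TensorProduct.map f f ∘ₗ Coalgebra.comul = Coalgebra.comul ∘ₗ f := by
  refine LinearMap.ext fun c => tensor_ext_coeff fun p q => ?_
  have h : conv (coeff p ∘ₗ f) (coeff q ∘ₗ f) = conv (coeff p) (coeff q) ∘ₗ f := by
    obtain ⟨b', d, p⟩ := p
    obtain ⟨a, b, q⟩ := q
    by_cases h : b = b'
    · subst h
      rw [isPathSystem_coeff.path_path]
      exact hf.path_path q p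
    · rw [isPathSystem_coeff.path_path_of_ne q p h, LinearMap.zero_comp]
      exact hf.path_path_of_ne q p h
  have := LinearMap.congr_fun h c
  rw [conv, TensorProduct.map_comp] at this
  exact this

/-- A linear map into `kQ` that respects comultiplication is determined by its components in
`kQ_0` and `kQ_1`. -/
theorem hom_ext_proj {f g : C →ₗ[k] PathCoalgebra k V}
    (hf : TensorProduct.map f f ∘ₗ Coalgebra.comul = Coalgebra.comul ∘ₗ f)
    (hg : TensorProduct.map g g ∘ₗ Coalgebra.comul = Coalgebra.comul ∘ₗ g)
    (h0 : vertexProj ∘ₗ f = vertexProj ∘ₗ g) (h1 : arrowProj ∘ₗ f = arrowProj ∘ₗ g) : f = g := by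
  refine hom_ext_coeff fun ⟨a, b, p⟩ => ?_
  induction p with
  | nil =>
    change coeff (.nil a) ∘ₗ f = coeff (.nil a) ∘ₗ g
    rw [coeff_nil_eq, LinearMap.comp_assoc, h0, LinearMap.comp_assoc]
  | cons p e ih =>
    rw [← isPathSystem_coeff.arrow_path, conv_comp hf, conv_comp hg, ih, coeff_arrow_eq,
      LinearMap.comp_assoc, h1, LinearMap.comp_assoc]

/-! ### Construction of maps into the path coalgebra -/

open scoped Classical in
/-- Concatenation `a ⊗ p ↦ ap` of an arrow and a path; it is zero if `s(a) ≠ t(p)`. -/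
def concat : ArrowSpace k V →ₗ[k] PathCoalgebra k V →ₗ[k] PathCoalgebra k V :=
  Finsupp.lift _ k (Quiver.Total V) fun e => (basis k V).constr k fun p =>
    if h : p.tgt = e.left then ofPath k ((p.path.cast rfl h).cons e.hom) else 0

open scoped Classical in
theorem concat_single (e : Quiver.Total V) {a b : V} (p : Quiver.Path a b) :
    concat (Finsupp.single e (1 : k)) (ofPath k p) =
      if h : b = e.left then ofPath k ((p.cast rfl h).cons e.hom) else 0 := by
  simp [concat, ofPath, Module.Basis.constr_basis]

theorem coeff_nil_concat (g : V) (m : ArrowSpace k V) (x : PathCoalgebra k V) :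
    coeff (.nil g) (concat m x) = 0 := by
  classical
  refine LinearMap.congr_fun₂ (f := concat.compr₂ (coeff (.nil g))) (g := 0) ?_ m x
  refine arrow_hom_ext fun e => hom_ext_ofPath fun a b p => ?_
  simp only [LinearMap.compr₂_apply, LinearMap.zero_apply, concat_single]
  split_ifs with h
  · rw [coeff_ofPath, if_neg]
    simp [PathOf.mk_eq_nil]
  · simp

theorem coeff_cons_concat {a b c : V} (p : Quiver.Path a b) (e : b ⟶ c) (m : ArrowSpace k V)
    (x : PathCoalgebra k V) :
    coeff ⟨a, c, p.cons e⟩ (concat m x) = m ⟨b, c, e⟩ * coeff ⟨a, b, p⟩ x := by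
  classical
  refine LinearMap.congr_fun₂ (f := concat.compr₂ (coeff ⟨a, c, p.cons e⟩))
    (g := (LinearMap.mul k k).compl₁₂ (Finsupp.lapply ⟨b, c, e⟩) (coeff ⟨a, b, p⟩)) ?_ m x
  refine arrow_hom_ext fun ⟨l, r, e'⟩ => hom_ext_ofPath fun a' b' q => ?_
  simp only [LinearMap.compr₂_apply, LinearMap.compl₁₂_apply, concat_single, LinearMap.mul_apply',
    Finsupp.lapply_apply, Finsupp.single_apply, coeff_ofPath]
  by_cases hb : b' = l
  · subst hb
    rw [dif_pos rfl, Quiver.Path.cast_rfl_rfl, coeff_ofPath, PathOf.mk_cons_eq,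
      ite_zero_mul_ite_zero, one_mul]
    simp only [and_comm]
  · rw [dif_neg hb, map_zero, eq_comm, mul_eq_zero]
    by_contra hc
    simp only [not_or, ite_eq_right_iff, one_ne_zero, imp_false, not_not] at hc
    exact hb ((congrArg PathOf.tgt hc.2).trans (congrArg Quiver.Total.left hc.1).symm)

/-- The component of degree `n` of the map `C → kQ` with components `f₀ : C → kQ_0` and
`f₁ : C → kQ_1`: it sends `c` to the sum of the concatenations
`f₁(c₁) ⋯ f₁(cₙ) f₀(cₙ₊₁)`. No compatibility of `f₀` and `f₁` is needed for the definition. -/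
def stage (f₀ : C →ₗ[k] MonoidAlgebra k V) (f₁ : C →ₗ[k] ArrowSpace k V) :
    ℕ → C →ₗ[k] PathCoalgebra k V
  | 0 => vertexIncl k V ∘ₗ f₀
  | n + 1 => TensorProduct.lift concat ∘ₗ TensorProduct.map f₁ (stage f₀ f₁ n) ∘ₗ Coalgebra.comul

variable (f₀ : C →ₗ[k] MonoidAlgebra k V) (f₁ : C →ₗ[k] ArrowSpace k V)

theorem coeff_nil_stage_zero (g : V) :
    coeff (.nil g) ∘ₗ stage f₀ f₁ 0 = vertexCoord g ∘ₗ f₀ := by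
  ext c
  simp [stage, coeff_nil_eq]

theorem coeff_nil_stage_succ (g : V) (n : ℕ) : coeff (.nil g) ∘ₗ stage f₀ f₁ (n + 1) = 0 := by
  have : coeff (.nil g) ∘ₗ TensorProduct.lift (concat (k := k) (V := V)) = 0 :=
    TensorProduct.ext' fun m x => by simp [coeff_nil_concat]
  rw [stage, ← LinearMap.comp_assoc, this, LinearMap.zero_comp]

theorem coeff_cons_stage_zero {a b c : V} (p : Quiver.Path a b) (e : b ⟶ c) :
    coeff ⟨a, c, p.cons e⟩ ∘ₗ stage f₀ f₁ 0 = 0 := by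
  have : coeff ⟨a, c, p.cons e⟩ ∘ₗ vertexIncl k V = 0 := by
    classical
    refine vertex_hom_ext fun x => ?_
    simp only [LinearMap.comp_apply, vertexIncl_single, one_smul, coeff_ofPath,
      LinearMap.zero_apply]
    rw [if_neg]
    intro h
    have := (PathOf.mk_eq_nil (p.cons e) x).mp h.symm
    simp at this
  rw [stage, ← LinearMap.comp_assoc, this, LinearMap.zero_comp]

theorem coeff_cons_stage_succ {a b c : V} (p : Quiver.Path a b) (e : b ⟶ c) (n : ℕ) :
    coeff ⟨a, c, p.cons e⟩ ∘ₗ stage f₀ f₁ (n + 1) =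
      conv (Finsupp.lapply ⟨b, c, e⟩ ∘ₗ f₁) (coeff ⟨a, b, p⟩ ∘ₗ stage f₀ f₁ n) := by
  have : coeff ⟨a, c, p.cons e⟩ ∘ₗ TensorProduct.lift (concat (k := k) (V := V)) =
      LinearMap.mul' k k ∘ₗ TensorProduct.map (Finsupp.lapply ⟨b, c, e⟩) (coeff ⟨a, b, p⟩) :=
    TensorProduct.ext' fun m x => by simp [coeff_cons_concat]
  rw [stage, ← LinearMap.comp_assoc, this, conv, TensorProduct.map_comp]
  simp only [LinearMap.comp_assoc]

/-- The degree `n` component lies in `kQ_n`. -/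
theorem coeff_stage_of_ne {a b : V} (p : Quiver.Path a b) {n : ℕ} (h : p.length ≠ n) :
    coeff ⟨a, b, p⟩ ∘ₗ stage f₀ f₁ n = 0 := by
  induction p generalizing n with
  | nil =>
    cases n with
    | zero => simp at h
    | succ n => exact coeff_nil_stage_succ f₀ f₁ a n
  | cons p e ih =>
    cases n with
    | zero => exact coeff_cons_stage_zero f₀ f₁ p e
    | succ n => rw [coeff_cons_stage_succ, ih (by simpa using h), conv_zero]

theorem conv_comp_comp {N P : Type*} [AddCommGroup N] [Module k N] [AddCommGroup P] [Module k P]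
    (α : N →ₗ[k] k) (β : P →ₗ[k] k) (u : C →ₗ[k] N) (v : C →ₗ[k] P) :
    conv (α ∘ₗ u) (β ∘ₗ v) = (LinearMap.mul' k k ∘ₗ TensorProduct.map α β) ∘ₗ
      (TensorProduct.map u v ∘ₗ Coalgebra.comul) := by
  rw [conv, TensorProduct.map_comp]
  simp only [LinearMap.comp_assoc]

open scoped Classical in
theorem vertexCoord_vertexCoord_comul {X : Type*} (g h : X) :
    (LinearMap.mul' k k ∘ₗ TensorProduct.map (vertexCoord g) (vertexCoord h)) ∘ₗ
      Coalgebra.comul = if h = g then vertexCoord h else 0 := by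
  refine vertex_hom_ext fun x => ?_
  by_cases hx : x = h
  · subst hx
    split_ifs with hg <;> simp [vertexCoord_single, hg]
  · split_ifs <;> simp [vertexCoord_single, hx]

open scoped Classical in
theorem vertexCoord_lapply_lcoact (g : V) (e : Quiver.Total V) :
    (LinearMap.mul' k k ∘ₗ TensorProduct.map (vertexCoord g) (Finsupp.lapply e)) ∘ₗ
      (arrowBicomodule k V).lcoact = if e.right = g then Finsupp.lapply e else 0 := by
  refine arrow_hom_ext fun x => ?_
  by_cases hx : x = e
  · subst hx
    split_ifs with hg <;> simp [arrowBicomodule, vertexCoord_single, hg]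
  · split_ifs <;> simp [arrowBicomodule, vertexCoord_single, hx]

open scoped Classical in
theorem lapply_vertexCoord_rcoact (e : Quiver.Total V) (g : V) :
    (LinearMap.mul' k k ∘ₗ TensorProduct.map (Finsupp.lapply e) (vertexCoord g)) ∘ₗ
      (arrowBicomodule k V).rcoact = if e.left = g then Finsupp.lapply e else 0 := by
  refine arrow_hom_ext fun x => ?_
  by_cases hx : x = e
  · subst hx
    split_ifs with hg <;> simp [arrowBicomodule, vertexCoord_single, hg]
  · split_ifs <;> simp [arrowBicomodule, vertexCoord_single, hx]

theorem coeff_nil_of_stage {f : C →ₗ[k] PathCoalgebra k V}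
    (hf : ∀ {a b : V} (p : Quiver.Path a b),
      coeff ⟨a, b, p⟩ ∘ₗ f = coeff ⟨a, b, p⟩ ∘ₗ stage f₀ f₁ p.length) (g : V) :
    coeff (.nil g) ∘ₗ f = vertexCoord g ∘ₗ f₀ :=
  (hf _).trans (coeff_nil_stage_zero f₀ f₁ g)

theorem coeff_arrow_of_stage
    (hr : TensorProduct.map f₁ f₀ ∘ₗ Coalgebra.comul = (arrowBicomodule k V).rcoact ∘ₗ f₁)
    {f : C →ₗ[k] PathCoalgebra k V}
    (hf : ∀ {a b : V} (p : Quiver.Path a b),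
      coeff ⟨a, b, p⟩ ∘ₗ f = coeff ⟨a, b, p⟩ ∘ₗ stage f₀ f₁ p.length) (e : Quiver.Total V) :
    coeff (.arrow e) ∘ₗ f = Finsupp.lapply e ∘ₗ f₁ := by
  refine (hf _).trans ((coeff_cons_stage_succ f₀ f₁ _ _ 0).trans ?_)
  change conv _ (coeff (.nil e.left) ∘ₗ _) = _
  rw [coeff_nil_stage_zero, conv_comp_comp, hr, ← LinearMap.comp_assoc,
    lapply_vertexCoord_rcoact, if_pos rfl]

/-- A linear map into `kQ` whose coordinates are those of the maps `stage f₀ f₁ n` respects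
comultiplication, if `f₀` does and `f₁` respects the coactions along `f₀`. -/
theorem isPathSystem_of_stage
    (h₀ : TensorProduct.map f₀ f₀ ∘ₗ Coalgebra.comul = Coalgebra.comul ∘ₗ f₀)
    (hl : TensorProduct.map f₀ f₁ ∘ₗ Coalgebra.comul = (arrowBicomodule k V).lcoact ∘ₗ f₁)
    (hr : TensorProduct.map f₁ f₀ ∘ₗ Coalgebra.comul = (arrowBicomodule k V).rcoact ∘ₗ f₁)
    {f : C →ₗ[k] PathCoalgebra k V}
    (hf : ∀ {a b : V} (p : Quiver.Path a b),
      coeff ⟨a, b, p⟩ ∘ₗ f = coeff ⟨a, b, p⟩ ∘ₗ stage f₀ f₁ p.length) :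
    IsPathSystem fun p => coeff p ∘ₗ f := by
  classical
  have hv := coeff_nil_of_stage f₀ f₁ hf
  have ha := coeff_arrow_of_stage f₀ f₁ hr hf
  refine ⟨fun g h => ?_, fun g e => ?_, fun e g => ?_, fun p e => ?_⟩
  · rw [hv, hv, conv_comp_comp, h₀, ← LinearMap.comp_assoc, vertexCoord_vertexCoord_comul]
    split_ifs <;> simp
  · rw [hv, ha, conv_comp_comp, hl, ← LinearMap.comp_assoc, vertexCoord_lapply_lcoact]
    split_ifs <;> simp
  · rw [hv, ha, conv_comp_comp, hr, ← LinearMap.comp_assoc, lapply_vertexCoord_rcoact]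
    split_ifs <;> simp
  · rw [ha, hf, hf, Quiver.Path.length_cons, coeff_cons_stage_succ]

end Systems

section Product

variable {k : Type w} [Field k] {V : Type u} [Quiver.{v} V]

/-! ### The graded components of the path coalgebra -/

theorem length_of_mem_splits {a b : V} (p : Quiver.Path a b) :
    ∀ q ∈ splits p, q.2.1.length + q.2.2.length = p.length := by
  induction p with
  | nil => simp [splits]
  | cons p e ih =>
    intro q hq
    simp only [splits, List.mem_cons, List.mem_map] at hq
    rcases hq with rfl | ⟨r, hr, rfl⟩
    · simp
    · simp [← ih r hr, add_assoc]

theorem ofPath_mem_component {a b : V} (p : Quiver.Path a b) :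
    ofPath k p ∈ component k V p.length :=
  Submodule.subset_span ⟨a, b, p, rfl, rfl⟩

theorem coeff_of_mem_component {n : ℕ} {x : PathCoalgebra k V} (hx : x ∈ component k V n)
    {a b : V} (p : Quiver.Path a b) (h : p.length ≠ n) : coeff ⟨a, b, p⟩ x = 0 := by
  classical
  have : component k V n ≤ LinearMap.ker (coeff (k := k) ⟨a, b, p⟩) := by
    refine Submodule.span_le.mpr ?_
    rintro _ ⟨c, d, q, rfl, rfl⟩
    rw [SetLike.mem_coe, LinearMap.mem_ker, coeff_ofPath, if_neg]
    rintro h'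
    obtain ⟨rfl, h1⟩ := (PathOf.mk.injEq ..).mp h'
    obtain ⟨rfl, h2⟩ := h1
    exact h (congrArg Quiver.Path.length (eq_of_heq h2).symm)
  exact this hx

theorem mem_component_of_coeff {n : ℕ} {x : PathCoalgebra k V}
    (h : ∀ {a b : V} (p : Quiver.Path a b), p.length ≠ n → coeff ⟨a, b, p⟩ x = 0) :
    x ∈ component k V n := by
  rw [← (basis k V).linearCombination_repr x, Finsupp.linearCombination_apply]
  refine Submodule.sum_mem _ fun p _ => ?_
  by_cases hp : p.path.length = n
  · subst hp
    exact Submodule.smul_mem _ _ (ofPath_mem_component p.path)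
  · have : (basis k V).repr x p = 0 := h p.path hp
    simp [this]

theorem vertexIncl_mem (b : MonoidAlgebra k V) : vertexIncl k V b ∈ component k V 0 := by
  induction b using MonoidAlgebra.induction_linear with
  | zero => simp
  | add x y hx hy => rw [map_add]; exact Submodule.add_mem _ hx hy
  | single x c =>
    rw [vertexIncl_single]
    exact Submodule.smul_mem _ _ (ofPath_mem_component (Quiver.Path.nil : Quiver.Path x x))

theorem arrowIncl_mem (m : ArrowSpace k V) : arrowIncl k V m ∈ component k V 1 := by
  induction m using Finsupp.induction_linear with
  | zero => simp
  | add x y hx hy => rw [map_add]; exact Submodule.add_mem _ hx hy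
  | single x c =>
    rw [arrowIncl_single]
    exact Submodule.smul_mem _ _ (ofPath_mem_component x.hom.toPath)

/-- An element whose coordinates vanish on all paths of length at least two is the sum of its
components in `kQ_0` and `kQ_1`. -/
theorem eq_incl_add_incl {x : PathCoalgebra k V}
    (h : ∀ {a b : V} (p : Quiver.Path a b), 2 ≤ p.length → coeff ⟨a, b, p⟩ x = 0) :
    x = vertexIncl k V (vertexProj x) + arrowIncl k V (arrowProj x) := by
  refine ext_coeff fun ⟨a, b, p⟩ => ?_
  rw [map_add]
  cases p with
  | nil =>
    rw [coeff_of_mem_component (arrowIncl_mem _) _ (by simp), add_zero]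
    change coeff (.nil a) x = coeff (.nil a) _
    rw [coeff_nil_eq, LinearMap.comp_apply, LinearMap.comp_apply, vertexProj_vertexIncl]
  | cons p e =>
    rw [coeff_of_mem_component (vertexIncl_mem _) _ (by simp), zero_add]
    cases p with
    | nil =>
      change coeff (.arrow ⟨a, b, e⟩) x = coeff (.arrow ⟨a, b, e⟩) _
      rw [coeff_arrow_eq, LinearMap.comp_apply, LinearMap.comp_apply, arrowProj_arrowIncl]
    | cons p e' =>
      rw [coeff_of_mem_component (arrowIncl_mem _) _ (by simp), h _ (by simp)]

theorem vertexProj_of_mem {n : ℕ} (hn : n ≠ 0) {x : PathCoalgebra k V}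
    (hx : x ∈ component k V n) : vertexProj x = 0 := by
  apply MonoidAlgebra.coeff_injective
  ext g
  exact coeff_of_mem_component hx (Quiver.Path.nil : Quiver.Path g g) (by simpa using hn.symm)

theorem arrowProj_of_mem {n : ℕ} (hn : n ≠ 1) {x : PathCoalgebra k V}
    (hx : x ∈ component k V n) : arrowProj x = 0 := by
  ext e
  exact coeff_of_mem_component hx e.hom.toPath (by simpa using hn.symm)

theorem vertexIncl_vertexProj {x : PathCoalgebra k V} (hx : x ∈ component k V 0) :
    vertexIncl k V (vertexProj x) = x := by
  have := eq_incl_add_incl (x := x) fun p hp => coeff_of_mem_component hx p (by omega)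
  rwa [arrowProj_of_mem (by simp) hx, map_zero, add_zero, eq_comm] at this

theorem arrowIncl_arrowProj {x : PathCoalgebra k V} (hx : x ∈ component k V 1) :
    arrowIncl k V (arrowProj x) = x := by
  have := eq_incl_add_incl (x := x) fun p hp => coeff_of_mem_component hx p (by omega)
  rwa [vertexProj_of_mem (by simp) hx, map_zero, zero_add, eq_comm] at this

theorem counit_eq_counit_vertexProj (x : PathCoalgebra k V) :
    Coalgebra.counit (R := k) x = Coalgebra.counit (R := k) (vertexProj x) := by
  refine LinearMap.congr_fun (f := Coalgebra.counit (R := k))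
    (g := Coalgebra.counit (R := k) ∘ₗ vertexProj) (hom_ext_ofPath fun a b p => ?_) x
  refine (counitMap_ofPath k p).trans ?_
  rw [LinearMap.comp_apply, vertexProj_ofPath]
  cases p <;> simp

theorem map_vertexProj_vertexProj_comul (x : PathCoalgebra k V) :
    TensorProduct.map vertexProj vertexProj (Coalgebra.comul (R := k) x) =
      Coalgebra.comul (R := k) (vertexProj x) := by
  refine LinearMap.congr_fun (f := TensorProduct.map vertexProj vertexProj ∘ₗ Coalgebra.comul)
    (g := Coalgebra.comul (R := k) ∘ₗ vertexProj) (hom_ext_ofPath fun a b p => ?_) x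
  rw [LinearMap.comp_apply, map_vertexProj_comul, LinearMap.comp_apply, vertexProj_ofPath]
  cases p <;> simp

theorem map_vertexProj_arrowProj_comul (x : PathCoalgebra k V) :
    TensorProduct.map vertexProj arrowProj (Coalgebra.comul (R := k) x) =
      (arrowBicomodule k V).lcoact (arrowProj x) := by
  refine LinearMap.congr_fun (f := TensorProduct.map vertexProj arrowProj ∘ₗ Coalgebra.comul)
    (g := (arrowBicomodule k V).lcoact ∘ₗ arrowProj) (hom_ext_ofPath fun a b p => ?_) x
  rw [LinearMap.comp_apply, map_vertexProj_comul, LinearMap.comp_apply]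
  cases p with
  | nil => simp
  | cons p e => cases p <;> simp [arrowProj_cons, arrowBicomodule]

theorem map_arrowProj_vertexProj_comul (x : PathCoalgebra k V) :
    TensorProduct.map arrowProj vertexProj (Coalgebra.comul (R := k) x) =
      (arrowBicomodule k V).rcoact (arrowProj x) := by
  refine LinearMap.congr_fun (hom_ext_ofPath (N := ArrowSpace k V ⊗[k] MonoidAlgebra k V)
    (f := TensorProduct.map (arrowProj (k := k) (V := V)) vertexProj ∘ₗ Coalgebra.comul (R := k))
    (g := (arrowBicomodule k V).rcoact ∘ₗ arrowProj) fun a b p => ?_) x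
  rw [LinearMap.comp_apply, map_comul_vertexProj, LinearMap.comp_apply]
  cases p with
  | nil => simp
  | cons p e =>
    cases p with
    | nil => simp [arrowProj_cons, arrowBicomodule]
    | cons p e' => simp [arrowProj_cons]

/-! ### Comultiplication of the product of two coalgebras -/

theorem map_comul_tmul {C D M N : Type*} [AddCommGroup C] [Module k C] [Coalgebra k C]
    [AddCommGroup D] [Module k D] [Coalgebra k D] [AddCommGroup M] [Module k M]
    [AddCommGroup N] [Module k N] (F : C →ₗ[k] D →ₗ[k] M) (G : C →ₗ[k] D →ₗ[k] N)
    (x : C) (y : D) :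
    TensorProduct.map (TensorProduct.lift F) (TensorProduct.lift G)
        (Coalgebra.comul (R := k) (x ⊗ₜ[k] y)) =
      TensorProduct.map₂ F G (Coalgebra.comul (R := k) x) (Coalgebra.comul (R := k) y) := by
  rw [TensorProduct.comul_tmul]
  generalize Coalgebra.comul (R := k) x = X
  generalize Coalgebra.comul (R := k) y = Y
  induction X with
  | zero => simp
  | add a b ha hb => simp only [TensorProduct.add_tmul, map_add, ha, hb, LinearMap.add_apply]
  | tmul a b =>
    induction Y with
    | zero => simp
    | add c d hc hd => simp only [TensorProduct.tmul_add, map_add, hc, hd]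
    | tmul c d => simp

theorem map₂_compl₁₂ {A B C D A' B' C' D' M N : Type*} [AddCommGroup A] [Module k A]
    [AddCommGroup B] [Module k B] [AddCommGroup C] [Module k C] [AddCommGroup D] [Module k D]
    [AddCommGroup A'] [Module k A'] [AddCommGroup B'] [Module k B'] [AddCommGroup C']
    [Module k C'] [AddCommGroup D'] [Module k D']
    [AddCommGroup M] [Module k M] [AddCommGroup N] [Module k N]
    (F : A →ₗ[k] B →ₗ[k] M) (G : C →ₗ[k] D →ₗ[k] N) (a : A' →ₗ[k] A) (b : B' →ₗ[k] B)
    (c : C' →ₗ[k] C) (d : D' →ₗ[k] D) (X : A' ⊗[k] C') (Y : B' ⊗[k] D') :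
    TensorProduct.map₂ (F.compl₁₂ a b) (G.compl₁₂ c d) X Y =
      TensorProduct.map₂ F G (TensorProduct.map a c X) (TensorProduct.map b d Y) := by
  induction X with
  | zero => simp
  | add a b ha hb => simp only [map_add, ha, hb, LinearMap.add_apply]
  | tmul a b =>
    induction Y with
    | zero => simp
    | add c d hc hd => simp only [map_add, hc, hd]
    | tmul c d => simp


theorem map₂_mul_mul {B D : Type*} [Ring B] [Algebra k B] [Ring D] [Algebra k D]
    (X Y : B ⊗[k] D) :
    TensorProduct.map₂ (LinearMap.mul k B) (LinearMap.mul k D) X Y = X * Y := by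
  induction X with
  | zero => simp
  | add a b ha hb => simp only [map_add, ha, hb, LinearMap.add_apply, add_mul]
  | tmul a b =>
    induction Y with
    | zero => simp
    | add c d hc hd => simp only [map_add, hc, hd, mul_add]
    | tmul c d => simp

theorem map₂_list_sum_eq_zero {M N P : Type*} [AddCommGroup M] [Module k M] [AddCommGroup N]
    [Module k N] [AddCommGroup P] [Module k P] (B : M →ₗ[k] N →ₗ[k] P) (l : List M) (l' : List N)
    (h : ∀ x ∈ l, ∀ y ∈ l', B x y = 0) : B l.sum l'.sum = 0 := by
  induction l with
  | nil => simp
  | cons x l ih =>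
    rw [List.sum_cons, map_add, LinearMap.add_apply, ih fun x hx => h x (List.mem_cons_of_mem _ hx),
      add_zero, ← List.map_id l', map_list_sum]
    exact List.sum_eq_zero fun z hz => by
      obtain ⟨y, hy, rfl⟩ := List.mem_map.mp hz
      exact h x List.mem_cons_self y hy

/-! ### The product attached to a bialgebra bimodule of arrows -/

variable [Monoid V] (A : BimoduleStructure k (MonoidAlgebra k V) (ArrowSpace k V))

variable (k V) in
/-- The component in `kQ_0` of the product on `kQ`: `x ⊗ y ↦ π₀(x) π₀(y)`. -/
def vertexPart : PathCoalgebra k V ⊗[k] PathCoalgebra k V →ₗ[k] MonoidAlgebra k V :=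
  TensorProduct.lift ((LinearMap.mul k (MonoidAlgebra k V)).compl₁₂ vertexProj vertexProj)

/-- The component in `kQ_1` of the product on `kQ`: `x ⊗ y ↦ π₀(x).π₁(y) + π₁(x).π₀(y)`. -/
def arrowPart : PathCoalgebra k V ⊗[k] PathCoalgebra k V →ₗ[k] ArrowSpace k V :=
  TensorProduct.lift (A.lact.compl₁₂ vertexProj arrowProj) +
    TensorProduct.lift (A.ract.compl₁₂ arrowProj vertexProj)

theorem vertexPart_tmul (x y : PathCoalgebra k V) :
    vertexPart k V (x ⊗ₜ y) = vertexProj x * vertexProj y := rfl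

theorem arrowPart_tmul (x y : PathCoalgebra k V) :
    arrowPart A (x ⊗ₜ y) =
      A.lact (vertexProj x) (arrowProj y) + A.ract (arrowProj x) (vertexProj y) := rfl

theorem vertexPart_comul :
    TensorProduct.map (vertexPart k V) (vertexPart k V) ∘ₗ Coalgebra.comul =
      Coalgebra.comul ∘ₗ vertexPart k V := by
  refine TensorProduct.ext' fun x y => ?_
  rw [LinearMap.comp_apply, vertexPart, map_comul_tmul, map₂_compl₁₂,
    map_vertexProj_vertexProj_comul, map_vertexProj_vertexProj_comul, map₂_mul_mul,
    ← Bialgebra.comul_mul]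
  rfl

variable {A}

theorem arrowPart_lcoact (hA : IsBialgebraBimodule A (arrowBicomodule k V)) :
    TensorProduct.map (vertexPart k V) (arrowPart A) ∘ₗ Coalgebra.comul =
      (arrowBicomodule k V).lcoact ∘ₗ arrowPart A := by
  refine TensorProduct.ext' fun x y => ?_
  rw [LinearMap.comp_apply, LinearMap.comp_apply, arrowPart_tmul, map_add, hA.lcoact_lact,
    hA.lcoact_ract, arrowPart, TensorProduct.map_add_right, LinearMap.add_apply, vertexPart,
    map_comul_tmul, map_comul_tmul, map₂_compl₁₂, map₂_compl₁₂]
  simp only [map_vertexProj_vertexProj_comul, map_vertexProj_arrowProj_comul]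

theorem arrowPart_rcoact (hA : IsBialgebraBimodule A (arrowBicomodule k V)) :
    TensorProduct.map (arrowPart A) (vertexPart k V) ∘ₗ Coalgebra.comul =
      (arrowBicomodule k V).rcoact ∘ₗ arrowPart A := by
  refine TensorProduct.ext' fun x y => ?_
  rw [LinearMap.comp_apply, LinearMap.comp_apply, arrowPart_tmul, map_add, hA.rcoact_lact,
    hA.rcoact_ract, arrowPart, TensorProduct.map_add_left, LinearMap.add_apply, vertexPart,
    map_comul_tmul, map_comul_tmul, map₂_compl₁₂, map₂_compl₁₂]
  simp only [map_vertexProj_vertexProj_comul, map_arrowProj_vertexProj_comul]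

variable (A)

theorem vertexPart_of_ne {a b c d : V} (p : Quiver.Path a b) (q : Quiver.Path c d)
    (h : p.length + q.length ≠ 0) : vertexPart k V (ofPath k p ⊗ₜ ofPath k q) = 0 := by
  rw [vertexPart_tmul]
  by_cases hp : p.length = 0
  · rw [vertexProj_of_mem (by omega) (ofPath_mem_component q), mul_zero]
  · rw [vertexProj_of_mem hp (ofPath_mem_component p), zero_mul]

theorem arrowPart_of_ne {a b c d : V} (p : Quiver.Path a b) (q : Quiver.Path c d)
    (h : p.length + q.length ≠ 1) : arrowPart A (ofPath k p ⊗ₜ ofPath k q) = 0 := by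
  have hl : A.lact (vertexProj (ofPath k p)) (arrowProj (ofPath k q)) = 0 := by
    by_cases hp : p.length = 0
    · rw [arrowProj_of_mem (by omega) (ofPath_mem_component q), map_zero]
    · rw [vertexProj_of_mem hp (ofPath_mem_component p), map_zero, LinearMap.zero_apply]
  have hr : A.ract (arrowProj (ofPath k p)) (vertexProj (ofPath k q)) = 0 := by
    by_cases hq : q.length = 0
    · rw [arrowProj_of_mem (by omega) (ofPath_mem_component p), map_zero, LinearMap.zero_apply]
    · rw [vertexProj_of_mem hq (ofPath_mem_component q), map_zero]
  rw [arrowPart_tmul, hl, hr, add_zero]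

/-- A product of paths of lengths `m` and `n` is concentrated in degree `m + n`. Hence for each pair
of basis elements at most one of the maps `stage _ _ n` is nonzero, and no infinite sum arises in the
definition of the product. -/
theorem stage_tmul_of_ne {n : ℕ} {a b c d : V} (p : Quiver.Path a b) (q : Quiver.Path c d)
    (h : p.length + q.length ≠ n) :
    stage (vertexPart k V) (arrowPart A) n (ofPath k p ⊗ₜ ofPath k q) = 0 := by
  induction n generalizing a b c d with
  | zero => rw [stage, LinearMap.comp_apply, vertexPart_of_ne p q h, map_zero]
  | succ n ih =>
    have key := map_comul_tmul (TensorProduct.curry (arrowPart A))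
      (TensorProduct.curry (stage (vertexPart k V) (arrowPart A) n)) (ofPath k p) (ofPath k q)
    have hc : ∀ {N : Type (max w u v)} [AddCommGroup N] [Module k N]
        (f : PathCoalgebra k V ⊗[k] PathCoalgebra k V →ₗ[k] N),
        TensorProduct.lift (TensorProduct.curry f) = f :=
      fun f => TensorProduct.ext' fun _ _ => rfl
    rw [hc, hc] at key
    rw [stage, LinearMap.comp_apply, LinearMap.comp_apply, key, comul_ofPath, comul_ofPath,
      ← LinearMap.compr₂_apply]
    refine map₂_list_sum_eq_zero _ _ _ ?_
    simp only [List.mem_map, forall_exists_index, and_imp, forall_apply_eq_imp_iff₂]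
    intro r hr r' hr'
    rw [LinearMap.compr₂_apply, TensorProduct.map₂_apply_tmul, TensorProduct.map_tmul,
      TensorProduct.lift.tmul]
    have h1 := length_of_mem_splits p r hr
    have h2 := length_of_mem_splits q r' hr'
    rw [TensorProduct.curry_apply, TensorProduct.curry_apply]
    by_cases h3 : r.2.2.length + r'.2.2.length = 1
    · rw [ih _ _ (by omega), map_zero]
    · rw [arrowPart_of_ne A _ _ h3, map_zero, LinearMap.zero_apply]

/-- The product on `kQ`, as a linear map on `kQ ⊗ kQ`: the map with components `vertexPart` and
`arrowPart`, given on each pair of paths by the component in the degree of the pair. -/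
def mulMap : PathCoalgebra k V ⊗[k] PathCoalgebra k V →ₗ[k] PathCoalgebra k V :=
  ((basis k V).tensorProduct (basis k V)).constr k fun i =>
    stage (vertexPart k V) (arrowPart A) (i.1.path.length + i.2.path.length)
      (ofPath k i.1.path ⊗ₜ ofPath k i.2.path)

theorem mulMap_ofPath {a b c d : V} (p : Quiver.Path a b) (q : Quiver.Path c d) :
    mulMap A (ofPath k p ⊗ₜ ofPath k q) =
      stage (vertexPart k V) (arrowPart A) (p.length + q.length)
        (ofPath k p ⊗ₜ ofPath k q) := by
  have := ((basis k V).tensorProduct (basis k V)).constr_basis k (fun i =>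
    stage (vertexPart k V) (arrowPart A) (i.1.path.length + i.2.path.length)
      (ofPath k i.1.path ⊗ₜ ofPath k i.2.path)) (⟨a, b, p⟩, ⟨c, d, q⟩)
  rwa [Module.Basis.tensorProduct_apply] at this

theorem coeff_mulMap {a b : V} (p : Quiver.Path a b) :
    coeff ⟨a, b, p⟩ ∘ₗ mulMap A =
      coeff ⟨a, b, p⟩ ∘ₗ stage (vertexPart k V) (arrowPart A) p.length := by
  refine ((basis k V).tensorProduct (basis k V)).ext fun ⟨⟨c, d, q⟩, ⟨c', d', q'⟩⟩ => ?_
  rw [Module.Basis.tensorProduct_apply]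
  change coeff _ (mulMap A (ofPath k q ⊗ₜ ofPath k q')) =
    coeff _ (stage _ _ _ (ofPath k q ⊗ₜ ofPath k q'))
  rw [mulMap_ofPath]
  by_cases h : q.length + q'.length = p.length
  · rw [h]
  · rw [stage_tmul_of_ne A q q' h, map_zero]
    exact LinearMap.congr_fun (coeff_stage_of_ne _ _ p (Ne.symm h)) _

theorem mulMap_mem {m n : ℕ} {x y : PathCoalgebra k V} (hx : x ∈ component k V m)
    (hy : y ∈ component k V n) : mulMap A (x ⊗ₜ y) ∈ component k V (m + n) := by
  induction hx using Submodule.span_induction with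
  | zero => simp
  | add x x' _ _ hx hx' =>
    rw [TensorProduct.add_tmul, map_add]
    exact Submodule.add_mem _ hx hx'
  | smul c x _ hx =>
    rw [← TensorProduct.smul_tmul', map_smul]
    exact Submodule.smul_mem _ _ hx
  | mem x hx =>
    obtain ⟨a, b, p, rfl, rfl⟩ := hx
    induction hy using Submodule.span_induction with
    | zero => simp
    | add x x' _ _ hx hx' =>
      rw [TensorProduct.tmul_add, map_add]
      exact Submodule.add_mem _ hx hx'
    | smul c x _ hx =>
      rw [TensorProduct.tmul_smul, map_smul]
      exact Submodule.smul_mem _ _ hx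
    | mem x hx =>
      obtain ⟨c, d, q, rfl, rfl⟩ := hx
      rw [mulMap_ofPath]
      exact mem_component_of_coeff fun r hr =>
        LinearMap.congr_fun (coeff_stage_of_ne _ _ r hr) _

end Product

/-! ### The graded bialgebra structure attached to a bialgebra bimodule of arrows -/

section GradedStructure

variable {k : Type w} [Field k] {V : Type u} [Quiver.{v} V] [Monoid V]
  {A : BimoduleStructure k (MonoidAlgebra k V) (ArrowSpace k V)}

theorem vertexProj_mulMap (x y : PathCoalgebra k V) :
    vertexProj (mulMap A (x ⊗ₜ y)) = vertexProj x * vertexProj y := by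
  apply MonoidAlgebra.coeff_injective
  ext g
  exact LinearMap.congr_fun (coeff_nil_of_stage _ _ (coeff_mulMap A) g) (x ⊗ₜ y)

theorem arrowProj_mulMap (hA : IsBialgebraBimodule A (arrowBicomodule k V))
    (x y : PathCoalgebra k V) :
    arrowProj (mulMap A (x ⊗ₜ y)) =
      A.lact (vertexProj x) (arrowProj y) + A.ract (arrowProj x) (vertexProj y) := by
  rw [← arrowPart_tmul]
  ext e
  exact LinearMap.congr_fun
    (coeff_arrow_of_stage _ _ (arrowPart_rcoact hA) (coeff_mulMap A) e) (x ⊗ₜ y)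

/-- The product on `kQ`, as a map of coalgebras. -/
def mulHom (hA : IsBialgebraBimodule A (arrowBicomodule k V)) :
    PathCoalgebra k V ⊗[k] PathCoalgebra k V →ₗc[k] PathCoalgebra k V where
  toLinearMap := mulMap A
  map_comp_comul := (isPathSystem_of_stage _ _ vertexPart_comul (arrowPart_lcoact hA)
    (arrowPart_rcoact hA) (coeff_mulMap A)).map_comp_comul
  counit_comp := TensorProduct.ext' fun x y => by
    rw [LinearMap.comp_apply, counit_eq_counit_vertexProj, vertexProj_mulMap,
      Bialgebra.counit_mul, TensorProduct.counit_tmul, counit_eq_counit_vertexProj x,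
      counit_eq_counit_vertexProj y, smul_eq_mul, mul_comm]

theorem mulMap_comul_mul (hA : IsBialgebraBimodule A (arrowBicomodule k V))
    (x y : PathCoalgebra k V) :
    Coalgebra.comul (R := k) (mulMap A (x ⊗ₜ y)) =
      TensorProduct.map₂ (TensorProduct.curry (mulMap A)) (TensorProduct.curry (mulMap A))
        (Coalgebra.comul (R := k) x) (Coalgebra.comul (R := k) y) := by
  rw [← map_comul_tmul, show TensorProduct.lift (TensorProduct.curry (mulMap A)) = mulMap A from
    TensorProduct.ext' fun _ _ => rfl]
  exact (LinearMap.congr_fun (mulHom hA).map_comp_comul (x ⊗ₜ y)).symm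

theorem vertexIncl_one_comul : Coalgebra.comul (R := k) (vertexIncl k V 1) =
    vertexIncl k V 1 ⊗ₜ[k] vertexIncl k V 1 := by
  rw [MonoidAlgebra.one_def, vertexIncl_single, one_smul, comul_ofPath]
  simp [splits]

/-- Both ways to multiply three factors are coalgebra maps, so it is enough to compare their
components in `kQ_0` and `kQ_1`, where associativity is that of `kS` and the bimodule axioms. -/
theorem mulMap_assoc (hA : IsBialgebraBimodule A (arrowBicomodule k V))
    (x y z : PathCoalgebra k V) :
    mulMap A (mulMap A (x ⊗ₜ y) ⊗ₜ z) = mulMap A (x ⊗ₜ mulMap A (y ⊗ₜ z)) := by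
  have := hom_ext_proj
    ((mulHom hA).comp (Coalgebra.TensorProduct.map (mulHom hA) (CoalgHom.id k _))).map_comp_comul
    (((mulHom hA).comp (Coalgebra.TensorProduct.map (CoalgHom.id k _) (mulHom hA))).comp
      (Coalgebra.TensorProduct.assoc k k (PathCoalgebra k V) (PathCoalgebra k V)
        (PathCoalgebra k V)).toCoalgHom).map_comp_comul
    (TensorProduct.ext_threefold fun x y z => by
      change vertexProj (mulMap A (mulMap A (x ⊗ₜ y) ⊗ₜ z)) =
        vertexProj (mulMap A (x ⊗ₜ mulMap A (y ⊗ₜ z)))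
      simp only [vertexProj_mulMap, mul_assoc])
    (TensorProduct.ext_threefold fun x y z => by
      change arrowProj (mulMap A (mulMap A (x ⊗ₜ y) ⊗ₜ z)) =
        arrowProj (mulMap A (x ⊗ₜ mulMap A (y ⊗ₜ z)))
      simp only [vertexProj_mulMap, arrowProj_mulMap hA, map_add, LinearMap.add_apply,
        A.mul_lact, A.ract_mul, A.lact_ract, add_assoc])
  exact LinearMap.congr_fun this ((x ⊗ₜ y) ⊗ₜ z)

theorem one_mulMap (hA : IsBialgebraBimodule A (arrowBicomodule k V)) (x : PathCoalgebra k V) :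
    mulMap A (vertexIncl k V 1 ⊗ₜ x) = x := by
  have := hom_ext_proj (f := TensorProduct.curry (mulMap A) (vertexIncl k V 1))
    (g := LinearMap.id)
    (LinearMap.ext fun x => by
      simp [mulMap_comul_mul hA, vertexIncl_one_comul])
    (by simp)
    (LinearMap.ext fun x => by simp [vertexProj_mulMap])
    (LinearMap.ext fun x => by simp [arrowProj_mulMap hA, A.one_lact])
  exact LinearMap.congr_fun this x

theorem map₂_tmul_right {C D M N P Q : Type*} [AddCommGroup C] [Module k C]
    [AddCommGroup D] [Module k D] [AddCommGroup M] [Module k M] [AddCommGroup N] [Module k N]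
    [AddCommGroup P] [Module k P] [AddCommGroup Q] [Module k Q]
    (F : C →ₗ[k] D →ₗ[k] M) (G : P →ₗ[k] Q →ₗ[k] N) (X : C ⊗[k] P) (y : D) (z : Q) :
    TensorProduct.map₂ F G X (y ⊗ₜ z) = TensorProduct.map (F.flip y) (G.flip z) X := by
  induction X with
  | zero => simp
  | add a b ha hb => simp only [map_add, ha, hb, LinearMap.add_apply]
  | tmul a b => simp

theorem mulMap_one (hA : IsBialgebraBimodule A (arrowBicomodule k V)) (x : PathCoalgebra k V) :
    mulMap A (x ⊗ₜ vertexIncl k V 1) = x := by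
  have := hom_ext_proj (f := (TensorProduct.curry (mulMap A)).flip (vertexIncl k V 1))
    (g := LinearMap.id)
    (LinearMap.ext fun x => by
      simp [mulMap_comul_mul hA, vertexIncl_one_comul, map₂_tmul_right])
    (by simp)
    (LinearMap.ext fun x => by simp [vertexProj_mulMap])
    (LinearMap.ext fun x => by simp [arrowProj_mulMap hA, A.ract_one])
  exact LinearMap.congr_fun this x

/-- The graded bialgebra structure on `kQ` attached to a bialgebra bimodule of arrows. -/
def bialgebraOfBimodule (hA : IsBialgebraBimodule A (arrowBicomodule k V)) :
    BialgebraStructure k (PathCoalgebra k V) where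
  mul := TensorProduct.curry (mulMap A)
  one := vertexIncl k V 1
  mul_assoc := mulMap_assoc hA
  one_mul := one_mulMap hA
  mul_one := mulMap_one hA
  comul_mul := mulMap_comul_mul hA
  comul_one := vertexIncl_one_comul
  counit_mul x y := by
    rw [TensorProduct.curry_apply, counit_eq_counit_vertexProj, vertexProj_mulMap,
      Bialgebra.counit_mul, ← counit_eq_counit_vertexProj, ← counit_eq_counit_vertexProj]
  counit_one := by
    rw [counit_eq_counit_vertexProj, vertexProj_vertexIncl, Bialgebra.counit_one]

theorem isGraded_bialgebraOfBimodule (hA : IsBialgebraBimodule A (arrowBicomodule k V)) :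
    (bialgebraOfBimodule hA).IsGraded where
  one_mem := vertexIncl_mem 1
  mul_mem _ _ _ _ := mulMap_mem A

theorem mulMap_vertexIncl_vertexIncl (b c : MonoidAlgebra k V) :
    mulMap A (vertexIncl k V b ⊗ₜ vertexIncl k V c) = vertexIncl k V (b * c) := by
  have h := mulMap_mem A (vertexIncl_mem b) (vertexIncl_mem c)
  rw [add_zero] at h
  rw [← vertexIncl_vertexProj h, vertexProj_mulMap, vertexProj_vertexIncl, vertexProj_vertexIncl]

theorem mulMap_vertexIncl_arrowIncl (hA : IsBialgebraBimodule A (arrowBicomodule k V))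
    (b : MonoidAlgebra k V) (m : ArrowSpace k V) :
    mulMap A (vertexIncl k V b ⊗ₜ arrowIncl k V m) = arrowIncl k V (A.lact b m) := by
  have h := mulMap_mem A (vertexIncl_mem b) (arrowIncl_mem m)
  rw [zero_add] at h
  rw [← arrowIncl_arrowProj h, arrowProj_mulMap hA, vertexProj_vertexIncl, arrowProj_vertexIncl,
    arrowProj_arrowIncl, map_zero, LinearMap.zero_apply, add_zero]

theorem mulMap_arrowIncl_vertexIncl (hA : IsBialgebraBimodule A (arrowBicomodule k V))
    (m : ArrowSpace k V) (b : MonoidAlgebra k V) :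
    mulMap A (arrowIncl k V m ⊗ₜ vertexIncl k V b) = arrowIncl k V (A.ract m b) := by
  have h := mulMap_mem A (arrowIncl_mem m) (vertexIncl_mem b)
  rw [add_zero] at h
  rw [← arrowIncl_arrowProj h, arrowProj_mulMap hA, vertexProj_vertexIncl, arrowProj_vertexIncl,
    arrowProj_arrowIncl, map_zero, zero_add]

end GradedStructure

section Restriction

variable {k : Type w} [Field k] {V : Type u} [Quiver.{v} V]

theorem restrictsTo_bialgebraOfBimodule (S : Monoid V) (A : ArrowBialgebraBimodule k V S) :
    (bialgebraOfBimodule A.2).RestrictsTo S A where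
  one_eq := rfl
  mul_vertex := mulMap_vertexIncl_vertexIncl
  mul_left := mulMap_vertexIncl_arrowIncl A.2
  mul_right := mulMap_arrowIncl_vertexIncl A.2

theorem restrictsTo_mul_single {H : BialgebraStructure k (PathCoalgebra k V)} (S : Monoid V)
    {A : ArrowBialgebraBimodule k V S} (h : H.RestrictsTo S A) (x y : V) :
    H.mul (vertexIncl k V (MonoidAlgebra.single x 1)) (vertexIncl k V (MonoidAlgebra.single y 1)) =
      vertexIncl k V (MonoidAlgebra.single (x * y) 1) := by
  rw [h.mul_vertex, MonoidAlgebra.single_mul_single, one_mul]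

/-- The multiplication and the actions that a bialgebra structure restricts to are determined by
it. -/
theorem restrictsTo_unique {H : BialgebraStructure k (PathCoalgebra k V)} {S S' : Monoid V}
    {A : ArrowBialgebraBimodule k V S} {A' : ArrowBialgebraBimodule k V S'}
    (h : H.RestrictsTo S A) (h' : H.RestrictsTo S' A') :
    (⟨S, A⟩ : Σ S : Monoid V, ArrowBialgebraBimodule k V S) = ⟨S', A'⟩ := by
  have hS : S = S' := by
    refine Monoid.ext ?_
    funext x y
    exact MonoidAlgebra.single_left_injective one_ne_zero (vertexIncl_injective
      ((restrictsTo_mul_single S h x y).symm.trans (restrictsTo_mul_single S' h' x y)))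
  subst hS
  have hA : A = A' := by
    refine Subtype.ext (BimoduleStructure.ext ?_ ?_)
    · exact LinearMap.ext₂ fun b m =>
        arrowIncl_injective ((h.mul_left b m).symm.trans (h'.mul_left b m))
    · exact LinearMap.ext₂ fun m b =>
        arrowIncl_injective ((h.mul_right m b).symm.trans (h'.mul_right m b))
  rw [hA]

end Restriction

section GroupLike

variable {k : Type w} [Field k] {V : Type u} [Quiver.{v} V]

/-! ### Group-like and skew-primitive elements of the path coalgebra -/

theorem exists_length_bound (x : PathCoalgebra k V) :
    ∃ N, ∀ {a b : V} (p : Quiver.Path a b), coeff ⟨a, b, p⟩ x ≠ 0 → p.length ≤ N := by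
  refine ⟨((basis k V).repr x).support.sup fun p => p.path.length, fun {a b} p hp => ?_⟩
  exact Finset.le_sup (f := fun p : PathOf V => p.path.length) (b := ⟨a, b, p⟩)
    (Finsupp.mem_support_iff.mpr hp)

/-- The group-like elements of the path coalgebra are the vertices. -/
theorem exists_eq_vertex {x : PathCoalgebra k V} (hx : Coalgebra.comul (R := k) x = x ⊗ₜ[k] x)
    (hε : Coalgebra.counit (R := k) x = 1) :
    ∃ g : V, x = ofPath k (Quiver.Path.nil : Quiver.Path g g) := by
  classical
  have hc : ∀ p q : PathOf V, conv (coeff p) (coeff q) x = coeff p x * coeff q x := by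
    intro p q
    simp [conv, hx]
  have hvv : ∀ g h : V, h ≠ g → coeff (.nil g) x * coeff (.nil h) x = 0 := by
    intro g h hgh
    rw [← hc, isPathSystem_coeff.vertex_vertex, if_neg hgh, LinearMap.zero_apply]
  have hpp : ∀ {a b c : V} (p : Quiver.Path a b) (q : Quiver.Path b c),
      coeff ⟨a, c, p.comp q⟩ x = coeff ⟨b, c, q⟩ x * coeff ⟨a, b, p⟩ x := by
    intro a b c p q
    rw [← hc, isPathSystem_coeff.path_path]
  have hloop : ∀ {a b : V} (p : Quiver.Path a b), coeff ⟨a, b, p⟩ x ≠ 0 → a = b := by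
    intro a b p hp
    have ha := hpp .nil p
    rw [Quiver.Path.nil_comp] at ha
    have hb := hpp p .nil
    rw [Quiver.Path.comp_nil] at hb
    by_contra hab
    refine mul_ne_zero ?_ ?_ (hvv b a hab)
    · exact left_ne_zero_of_mul (hb ▸ hp)
    · exact right_ne_zero_of_mul (ha ▸ hp)
  -- A path of positive length in the support is a loop, and so are all its powers.
  have hlong : ∀ {a b : V} (p : Quiver.Path a b), p.length ≠ 0 → coeff ⟨a, b, p⟩ x = 0 := by
    intro a b p hl
    by_contra hp
    obtain rfl := hloop p hp
    obtain ⟨N, hN⟩ := exists_length_bound x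
    have : ∀ n : ℕ, ∃ q : Quiver.Path a a, n < q.length ∧ coeff ⟨a, a, q⟩ x ≠ 0 := by
      intro n
      induction n with
      | zero => exact ⟨p, Nat.pos_of_ne_zero hl, hp⟩
      | succ n ih =>
        obtain ⟨q, hq, hq'⟩ := ih
        refine ⟨q.comp p, ?_, ?_⟩
        · rw [Quiver.Path.length_comp]
          omega
        · rw [hpp]
          exact mul_ne_zero hp hq'
    obtain ⟨q, hq, hq'⟩ := this N
    exact absurd (hN q hq') (by omega)
  obtain ⟨g, hg⟩ : ∃ g : V, coeff (.nil g) x ≠ 0 := by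
    by_contra! h
    have : x = 0 := by
      refine ext_coeff fun ⟨a, b, p⟩ => ?_
      rw [map_zero]
      cases p with
      | nil => exact h a
      | cons p e => exact hlong _ (by simp)
    rw [this, map_zero] at hε
    exact zero_ne_one hε
  have hg1 : coeff (.nil g) x = 1 := by
    have := hc (.nil g) (.nil g)
    rw [isPathSystem_coeff.vertex_vertex, if_pos rfl] at this
    exact (mul_eq_left₀ hg).mp this.symm
  refine ⟨g, ext_coeff fun ⟨a, b, p⟩ => ?_⟩
  rw [coeff_ofPath]
  split_ifs with h
  · rw [← h]
    exact hg1
  · cases p with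
    | nil =>
      refine (mul_eq_zero.mp (hvv g a ?_)).resolve_left hg
      rintro rfl
      exact h rfl
    | cons p e => exact hlong _ (by simp)

/-- Skew-primitive elements with respect to elements of `kQ_0` lie in `kQ_0 + kQ_1`. -/
theorem eq_incl_add_incl_of_comul {x y z : PathCoalgebra k V} (hy : y ∈ component k V 0)
    (hz : z ∈ component k V 0)
    (hx : Coalgebra.comul (R := k) x = y ⊗ₜ[k] x + x ⊗ₜ[k] z) :
    x = vertexIncl k V (vertexProj x) + arrowIncl k V (arrowProj x) := by
  refine eq_incl_add_incl fun p hp => ?_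
  cases p with
  | nil => simp at hp
  | cons p e =>
    rw [Quiver.Path.length_cons] at hp
    rw [← isPathSystem_coeff.arrow_path, conv, LinearMap.comp_apply, LinearMap.comp_apply, hx,
      map_add, TensorProduct.map_tmul, TensorProduct.map_tmul, PathOf.arrow,
      coeff_of_mem_component hy _ (by simp), coeff_of_mem_component hz p (by omega)]
    simp

theorem comul_vertex (g : V) :
    Coalgebra.comul (R := k) (ofPath k (Quiver.Path.nil : Quiver.Path g g)) =
      ofPath k (Quiver.Path.nil : Quiver.Path g g) ⊗ₜ[k]
        ofPath k (Quiver.Path.nil : Quiver.Path g g) := by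
  simp [comul_ofPath, splits]

theorem comul_arrow (e : Quiver.Total V) :
    Coalgebra.comul (R := k) (ofPath k e.hom.toPath) =
      ofPath k (Quiver.Path.nil : Quiver.Path e.right e.right) ⊗ₜ[k] ofPath k e.hom.toPath +
      ofPath k e.hom.toPath ⊗ₜ[k] ofPath k (Quiver.Path.nil : Quiver.Path e.left e.left) := by
  simp [comul_ofPath, splits, Quiver.Hom.toPath]

theorem vertex_injective {g h : V} (hgh : ofPath k (Quiver.Path.nil : Quiver.Path g g) =
    ofPath k (Quiver.Path.nil : Quiver.Path h h)) : g = h :=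
  congrArg PathOf.src ((basis k V).injective hgh)

/-! ### The bialgebra bimodule attached to a bialgebra structure -/

variable (H : BialgebraStructure k (PathCoalgebra k V))

theorem exists_vertex_mul (g h : V) : ∃ l : V,
    H.mul (ofPath k (Quiver.Path.nil : Quiver.Path g g))
      (ofPath k (Quiver.Path.nil : Quiver.Path h h)) =
      ofPath k (Quiver.Path.nil : Quiver.Path l l) := by
  have hε : ∀ l : V,
      Coalgebra.counit (R := k) (ofPath k (Quiver.Path.nil : Quiver.Path l l)) = 1 := fun l =>
    (counitMap_ofPath k _).trans (if_pos rfl)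
  refine exists_eq_vertex ?_ ?_
  · rw [H.comul_mul, comul_vertex, comul_vertex, TensorProduct.map₂_apply_tmul,
      TensorProduct.map_tmul]
  · rw [H.counit_mul, hε, hε, one_mul]

/-- The vertices form a monoid under the multiplication of a bialgebra structure. -/
theorem exists_monoid : ∃ _ : Monoid V, H.one = vertexIncl k V 1 ∧
    ∀ b c : MonoidAlgebra k V,
      H.mul (vertexIncl k V b) (vertexIncl k V c) = vertexIncl k V (b * c) := by
  choose m hm using exists_vertex_mul H
  obtain ⟨e, he⟩ := exists_eq_vertex H.comul_one H.counit_one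
  let S : Monoid V :=
    { mul := m
      one := e
      mul_assoc := fun x y z => vertex_injective (k := k) <| by
        change ofPath k (Quiver.Path.nil : Quiver.Path (m (m x y) z) (m (m x y) z)) =
          ofPath k (Quiver.Path.nil : Quiver.Path (m x (m y z)) (m x (m y z)))
        rw [← hm, ← hm, ← hm, ← hm, H.mul_assoc]
      one_mul := fun x => vertex_injective (k := k) <| by
        change ofPath k (Quiver.Path.nil : Quiver.Path (m e x) (m e x)) = _
        rw [← hm, ← he, H.one_mul]
      mul_one := fun x => vertex_injective (k := k) <| by
        change ofPath k (Quiver.Path.nil : Quiver.Path (m x e) (m x e)) = _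
        rw [← hm, ← he, H.mul_one] }
  refine ⟨S, ?_, fun b c => ?_⟩
  · rw [MonoidAlgebra.one_def, vertexIncl_single, one_smul]
    exact he
  · refine LinearMap.congr_fun₂ (f := H.mul.compl₁₂ (vertexIncl k V) (vertexIncl k V))
      (g := (LinearMap.mul k (MonoidAlgebra k V)).compr₂ (vertexIncl k V)) ?_ b c
    refine vertex_hom_ext fun x => vertex_hom_ext fun y => ?_
    rw [LinearMap.compl₁₂_apply, LinearMap.compr₂_apply, LinearMap.mul_apply',
      MonoidAlgebra.single_mul_single, vertexIncl_single, vertexIncl_single, vertexIncl_single,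
      one_smul, one_smul, mul_one, one_smul]
    exact hm x y

variable {H}

section Bimodule

variable [Monoid V]

/-- The product of a vertex and an arrow is skew-primitive, so it has no components of degree two
or more, even if the bialgebra structure is not graded. -/
theorem mul_vertexIncl_arrowIncl_eq (hm : ∀ b c : MonoidAlgebra k V,
      H.mul (vertexIncl k V b) (vertexIncl k V c) = vertexIncl k V (b * c))
    (b : MonoidAlgebra k V) (m : ArrowSpace k V) :
    H.mul (vertexIncl k V b) (arrowIncl k V m) =
      vertexIncl k V (vertexProj (H.mul (vertexIncl k V b) (arrowIncl k V m))) +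
      arrowIncl k V (arrowProj (H.mul (vertexIncl k V b) (arrowIncl k V m))) := by
  refine LinearMap.congr_fun₂ (f := H.mul.compl₁₂ (vertexIncl k V) (arrowIncl k V))
    (g := (H.mul.compl₁₂ (vertexIncl k V) (arrowIncl k V)).compr₂
      (vertexIncl k V ∘ₗ vertexProj + arrowIncl k V ∘ₗ arrowProj)) ?_ b m
  refine vertex_hom_ext fun x => arrow_hom_ext fun e => ?_
  refine eq_incl_add_incl_of_comul
    (y := H.mul (vertexIncl k V (.single x 1)) (vertexIncl k V (.single e.right 1)))
    (z := H.mul (vertexIncl k V (.single x 1)) (vertexIncl k V (.single e.left 1))) ?_ ?_ ?_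
  · rw [hm]; exact vertexIncl_mem _
  · rw [hm]; exact vertexIncl_mem _
  · simp only [LinearMap.compl₁₂_apply, vertexIncl_single, arrowIncl_single, one_smul]
    rw [H.comul_mul, comul_vertex, comul_arrow, map_add, TensorProduct.map₂_apply_tmul]
    rfl

theorem mul_arrowIncl_vertexIncl_eq (hm : ∀ b c : MonoidAlgebra k V,
      H.mul (vertexIncl k V b) (vertexIncl k V c) = vertexIncl k V (b * c))
    (m : ArrowSpace k V) (b : MonoidAlgebra k V) :
    H.mul (arrowIncl k V m) (vertexIncl k V b) =
      vertexIncl k V (vertexProj (H.mul (arrowIncl k V m) (vertexIncl k V b))) +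
      arrowIncl k V (arrowProj (H.mul (arrowIncl k V m) (vertexIncl k V b))) := by
  refine LinearMap.congr_fun₂ (f := H.mul.compl₁₂ (arrowIncl k V) (vertexIncl k V))
    (g := (H.mul.compl₁₂ (arrowIncl k V) (vertexIncl k V)).compr₂
      (vertexIncl k V ∘ₗ vertexProj + arrowIncl k V ∘ₗ arrowProj)) ?_ m b
  refine arrow_hom_ext fun e => vertex_hom_ext fun x => ?_
  refine eq_incl_add_incl_of_comul
    (y := H.mul (vertexIncl k V (.single e.right 1)) (vertexIncl k V (.single x 1)))
    (z := H.mul (vertexIncl k V (.single e.left 1)) (vertexIncl k V (.single x 1))) ?_ ?_ ?_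
  · rw [hm]; exact vertexIncl_mem _
  · rw [hm]; exact vertexIncl_mem _
  · simp only [LinearMap.compl₁₂_apply, vertexIncl_single, arrowIncl_single, one_smul]
    rw [H.comul_mul, comul_vertex, comul_arrow, map_add, LinearMap.add_apply,
      TensorProduct.map₂_apply_tmul, TensorProduct.map₂_apply_tmul]
    rfl

/-- Dropping the component in `kQ_0` of `x` does not change the component in `kQ_1` of a product of
`x` with a vertex, since the vertices span a subalgebra. -/
theorem arrowProj_mul_vertexIncl_incl_proj (hm : ∀ b c : MonoidAlgebra k V,
      H.mul (vertexIncl k V b) (vertexIncl k V c) = vertexIncl k V (b * c))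
    {x : PathCoalgebra k V}
    (hx : x = vertexIncl k V (vertexProj x) + arrowIncl k V (arrowProj x))
    (b : MonoidAlgebra k V) :
    arrowProj (H.mul (vertexIncl k V b) (arrowIncl k V (arrowProj x))) =
      arrowProj (H.mul (vertexIncl k V b) x) := by
  conv_rhs => rw [hx]
  rw [map_add, hm, map_add, arrowProj_vertexIncl, zero_add]

theorem arrowProj_mul_incl_proj_vertexIncl (hm : ∀ b c : MonoidAlgebra k V,
      H.mul (vertexIncl k V b) (vertexIncl k V c) = vertexIncl k V (b * c))
    {x : PathCoalgebra k V}
    (hx : x = vertexIncl k V (vertexProj x) + arrowIncl k V (arrowProj x))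
    (b : MonoidAlgebra k V) :
    arrowProj (H.mul (arrowIncl k V (arrowProj x)) (vertexIncl k V b)) =
      arrowProj (H.mul x (vertexIncl k V b)) := by
  conv_rhs => rw [hx]
  rw [map_add, LinearMap.add_apply, hm, map_add, arrowProj_vertexIncl, zero_add]

/-- The `kS`-bimodule of arrows attached to a bialgebra structure on `kQ`: an arrow is multiplied
by a vertex in `kQ`, and the component in `kQ_0` of the product is dropped. -/
def bimoduleOf (H : BialgebraStructure k (PathCoalgebra k V)) (h1 : H.one = vertexIncl k V 1)
    (hm : ∀ b c : MonoidAlgebra k V,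
      H.mul (vertexIncl k V b) (vertexIncl k V c) = vertexIncl k V (b * c)) :
    BimoduleStructure k (MonoidAlgebra k V) (ArrowSpace k V) where
  lact := (H.mul.compl₁₂ (vertexIncl k V) (arrowIncl k V)).compr₂ arrowProj
  ract := (H.mul.compl₁₂ (arrowIncl k V) (vertexIncl k V)).compr₂ arrowProj
  one_lact m := by simp [← h1, H.one_mul]
  mul_lact b c m := by
    simp only [LinearMap.compr₂_apply, LinearMap.compl₁₂_apply]
    rw [arrowProj_mul_vertexIncl_incl_proj hm (mul_vertexIncl_arrowIncl_eq hm c m), ← hm,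
      H.mul_assoc]
  ract_one m := by simp [← h1, H.mul_one]
  ract_mul m b c := by
    simp only [LinearMap.compr₂_apply, LinearMap.compl₁₂_apply]
    rw [arrowProj_mul_incl_proj_vertexIncl hm (mul_arrowIncl_vertexIncl_eq hm m b), ← hm,
      H.mul_assoc]
  lact_ract b m c := by
    simp only [LinearMap.compr₂_apply, LinearMap.compl₁₂_apply]
    rw [arrowProj_mul_incl_proj_vertexIncl hm (mul_vertexIncl_arrowIncl_eq hm b m),
      arrowProj_mul_vertexIncl_incl_proj hm (mul_arrowIncl_vertexIncl_eq hm m c), H.mul_assoc]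

theorem isBialgebraBimodule_bimoduleOf (h1 : H.one = vertexIncl k V 1)
    (hm : ∀ b c : MonoidAlgebra k V,
      H.mul (vertexIncl k V b) (vertexIncl k V c) = vertexIncl k V (b * c)) :
    IsBialgebraBimodule (bimoduleOf H h1 hm) (arrowBicomodule k V) := by
  have hv : ∀ g : V, ofPath k (Quiver.Path.nil : Quiver.Path g g) =
      vertexIncl k V (.single g 1) := fun g => by rw [vertexIncl_single, one_smul]
  have ha : ∀ e : Quiver.Total V, ofPath k e.hom.toPath = arrowIncl k V (.single e 1) :=
    fun e => by rw [arrowIncl_single, one_smul]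
  constructor
  · intro b m
    refine LinearMap.congr_fun₂
      (f := (bimoduleOf H h1 hm).lact.compr₂ (arrowBicomodule k V).lcoact)
      (g := (TensorProduct.map₂ (LinearMap.mul k _) (bimoduleOf H h1 hm).lact).compl₁₂
        Coalgebra.comul (arrowBicomodule k V).lcoact) ?_ b m
    refine vertex_hom_ext fun g => arrow_hom_ext fun e => ?_
    simp only [LinearMap.compr₂_apply, LinearMap.compl₁₂_apply, bimoduleOf]
    rw [← map_vertexProj_arrowProj_comul, H.comul_mul, ← hv, ← ha, comul_vertex, comul_arrow]
    simp [hv, ha, hm, arrowBicomodule]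
  · intro m b
    refine LinearMap.congr_fun₂
      (f := (bimoduleOf H h1 hm).ract.compr₂ (arrowBicomodule k V).lcoact)
      (g := (TensorProduct.map₂ (LinearMap.mul k _) (bimoduleOf H h1 hm).ract).compl₁₂
        (arrowBicomodule k V).lcoact Coalgebra.comul) ?_ m b
    refine arrow_hom_ext fun e => vertex_hom_ext fun g => ?_
    simp only [LinearMap.compr₂_apply, LinearMap.compl₁₂_apply, bimoduleOf]
    rw [← map_vertexProj_arrowProj_comul, H.comul_mul, ← hv, ← ha, comul_vertex, comul_arrow]
    simp [hv, ha, hm, arrowBicomodule]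
  · intro b m
    refine LinearMap.congr_fun₂
      (f := (bimoduleOf H h1 hm).lact.compr₂ (arrowBicomodule k V).rcoact)
      (g := (TensorProduct.map₂ (bimoduleOf H h1 hm).lact (LinearMap.mul k _)).compl₁₂
        Coalgebra.comul (arrowBicomodule k V).rcoact) ?_ b m
    refine vertex_hom_ext fun g => arrow_hom_ext fun e => ?_
    simp only [LinearMap.compr₂_apply, LinearMap.compl₁₂_apply, bimoduleOf]
    rw [← map_arrowProj_vertexProj_comul, H.comul_mul, ← hv, ← ha, comul_vertex, comul_arrow]
    simp [hv, ha, hm, arrowBicomodule]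
  · intro m b
    refine LinearMap.congr_fun₂
      (f := (bimoduleOf H h1 hm).ract.compr₂ (arrowBicomodule k V).rcoact)
      (g := (TensorProduct.map₂ (bimoduleOf H h1 hm).ract (LinearMap.mul k _)).compl₁₂
        (arrowBicomodule k V).rcoact Coalgebra.comul) ?_ m b
    refine arrow_hom_ext fun e => vertex_hom_ext fun g => ?_
    simp only [LinearMap.compr₂_apply, LinearMap.compl₁₂_apply, bimoduleOf]
    rw [← map_arrowProj_vertexProj_comul, H.comul_mul, ← hv, ← ha, comul_vertex, comul_arrow]
    simp [hv, ha, hm, arrowBicomodule]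

end Bimodule

end GroupLike

section Correspondence

variable {k : Type w} [Field k] {V : Type u} [Quiver.{v} V]

/-! ### The correspondence -/

/-- A bialgebra structure on `kQ` yields a monoid and a bialgebra bimodule of arrows, which are its
restrictions if the structure is graded. -/
theorem exists_restrictsTo (H : BialgebraStructure k (PathCoalgebra k V)) :
    ∃ (S : Monoid V) (A : ArrowBialgebraBimodule k V S), H.IsGraded → H.RestrictsTo S A := by
  obtain ⟨S, h1, hm⟩ := exists_monoid H
  refine ⟨S, ⟨bimoduleOf H h1 hm, isBialgebraBimodule_bimoduleOf h1 hm⟩, fun hH =>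
    ⟨h1, hm, fun b m => ?_, fun m b => ?_⟩⟩
  · have h := hH.mul_mem 0 1 _ _ (vertexIncl_mem b) (arrowIncl_mem m)
    rw [zero_add] at h
    exact (arrowIncl_arrowProj h).symm
  · have h := hH.mul_mem 1 0 _ _ (arrowIncl_mem m) (vertexIncl_mem b)
    rw [add_zero] at h
    exact (arrowIncl_arrowProj h).symm

theorem vertexProj_mul_of_isGraded {H : BialgebraStructure k (PathCoalgebra k V)}
    (hH : H.IsGraded) (S : Monoid V) {A : ArrowBialgebraBimodule k V S} (h : H.RestrictsTo S A) :
    vertexProj ∘ₗ TensorProduct.lift H.mul = vertexPart k V := by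
  refine ((basis k V).tensorProduct (basis k V)).ext fun ⟨⟨a, b, p⟩, ⟨c, d, q⟩⟩ => ?_
  rw [Module.Basis.tensorProduct_apply]
  change vertexProj (H.mul (ofPath k p) (ofPath k q)) = vertexPart k V (ofPath k p ⊗ₜ ofPath k q)
  by_cases hl : p.length + q.length = 0
  · have h0 : ∀ {x y : V} (r : Quiver.Path x y), r.length = 0 →
        vertexIncl k V (vertexProj (ofPath k r)) = ofPath k r := fun r hr =>
      vertexIncl_vertexProj (hr ▸ ofPath_mem_component r)
    rw [vertexPart_tmul, ← h0 p (by omega), ← h0 q (by omega), h.mul_vertex]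
    simp only [vertexProj_vertexIncl]
  · rw [vertexPart_of_ne p q hl, vertexProj_of_mem hl
      (hH.mul_mem _ _ _ _ (ofPath_mem_component p) (ofPath_mem_component q))]

theorem arrowProj_mul_of_isGraded {H : BialgebraStructure k (PathCoalgebra k V)}
    (hH : H.IsGraded) (S : Monoid V) {A : ArrowBialgebraBimodule k V S} (h : H.RestrictsTo S A) :
    arrowProj ∘ₗ TensorProduct.lift H.mul = arrowPart A.1 := by
  refine ((basis k V).tensorProduct (basis k V)).ext fun ⟨⟨a, b, p⟩, ⟨c, d, q⟩⟩ => ?_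
  rw [Module.Basis.tensorProduct_apply]
  change arrowProj (H.mul (ofPath k p) (ofPath k q)) = arrowPart A.1 (ofPath k p ⊗ₜ ofPath k q)
  by_cases hl : p.length + q.length = 1
  · have h0 : ∀ {x y : V} (r : Quiver.Path x y), r.length = 0 →
        vertexIncl k V (vertexProj (ofPath k r)) = ofPath k r := fun r hr =>
      vertexIncl_vertexProj (hr ▸ ofPath_mem_component r)
    have h1 : ∀ {x y : V} (r : Quiver.Path x y), r.length = 1 →
        arrowIncl k V (arrowProj (ofPath k r)) = ofPath k r := fun r hr =>
      arrowIncl_arrowProj (hr ▸ ofPath_mem_component r)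
    rw [arrowPart_tmul]
    by_cases hp : p.length = 0
    · rw [← h0 p hp, ← h1 q (by omega), h.mul_left]
      simp
    · rw [← h1 p (by omega), ← h0 q (by omega), h.mul_right]
      simp
  · rw [arrowPart_of_ne A.1 p q hl, arrowProj_of_mem hl
      (hH.mul_mem _ _ _ _ (ofPath_mem_component p) (ofPath_mem_component q))]

/-- A graded bialgebra structure is determined by its restrictions. -/
theorem eq_bialgebraOfBimodule {H : BialgebraStructure k (PathCoalgebra k V)}
    (hH : H.IsGraded) (S : Monoid V) {A : ArrowBialgebraBimodule k V S} (h : H.RestrictsTo S A) :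
    H = bialgebraOfBimodule A.2 := by
  refine BialgebraStructure.ext ?_ h.one_eq
  have key : TensorProduct.lift H.mul = mulMap A.1 := by
    refine hom_ext_proj ?_ (mulHom A.2).map_comp_comul ?_ ?_
    · refine TensorProduct.ext' fun x y => ?_
      rw [LinearMap.comp_apply, map_comul_tmul, ← H.comul_mul]
      rfl
    · rw [vertexProj_mul_of_isGraded hH S h]
      exact TensorProduct.ext' fun x y => (vertexProj_mulMap x y).symm
    · rw [arrowProj_mul_of_isGraded hH S h]
      exact TensorProduct.ext' fun x y => (arrowProj_mulMap A.2 x y).symm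
  exact LinearMap.ext₂ fun x y => LinearMap.congr_fun key (x ⊗ₜ y)

end Correspondence

end QuiverBialgebra
end

open QuiverBialgebra in
theorem lemma3p1 {k : Type w} [Field k] {V : Type u} [Quiver.{v} V] :
    (Nonempty (BialgebraStructure k (PathCoalgebra k V)) ↔
      ∃ S : Monoid V, Nonempty (ArrowBialgebraBimodule k V S)) ∧
    ∃ Φ : {H : BialgebraStructure k (PathCoalgebra k V) // H.IsGraded} ≃
        (Σ S : Monoid V, ArrowBialgebraBimodule k V S),
      ∀ H : {H : BialgebraStructure k (PathCoalgebra k V) // H.IsGraded},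
        H.1.RestrictsTo (Φ H).1 (Φ H).2 := by
  refine ⟨⟨fun ⟨H⟩ => ?_, fun ⟨S, ⟨A⟩⟩ => ⟨bialgebraOfBimodule A.2⟩⟩, ?_⟩
  · obtain ⟨S, A, -⟩ := exists_restrictsTo H
    exact ⟨S, ⟨A⟩⟩
  · choose S A h using fun H : {H : BialgebraStructure k (PathCoalgebra k V) // H.IsGraded} =>
      exists_restrictsTo H.1
    refine ⟨Equiv.ofBijective (fun H => ⟨S H, A H⟩) ⟨fun H H' hHH' => ?_, fun ⟨T, B⟩ => ?_⟩,
      fun H => h H H.2⟩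
    -- Stated for pairs, so that the equality of pairs can be eliminated.
    · have key : ∀ P P' : (Σ S : Monoid V, ArrowBialgebraBimodule k V S), P = P' →
          H.1.RestrictsTo P.1 P.2 → H'.1.RestrictsTo P'.1 P'.2 → H.1 = H'.1 := by
        rintro P _ rfl hP hP'
        rw [eq_bialgebraOfBimodule H.2 P.1 hP, eq_bialgebraOfBimodule H'.2 P.1 hP']
      exact Subtype.ext (key _ _ hHH' (h H H.2) (h H' H'.2))
    · have hB := isGraded_bialgebraOfBimodule B.2
      exact ⟨⟨_, hB⟩, restrictsTo_unique (h ⟨_, hB⟩ hB) (restrictsTo_bialgebraOfBimodule T B)⟩
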